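/- Setting. Let $d\ge 1$, $N\ge 1$, $0\le m\le d$ and let $k\ge 1$ be the frequency parameter. We consider an equation $Pu=0$ on $\mathbb R^d_x\times\mathbb R_t$ with a norm $\|\cdot\|_S$, in one of two cases: (a) the acoustic wave equation $P=\partial_t^2-c(x)^2\Delta$, with $c\in C^\infty(\mathbb R^d)$, $c>0$, and $\|u(\cdot,t)\|_S=\left(\frac12\int_{\mathbb R^d}c^{-2}|\partial_tu|^2+|\nabla_xu|^2\,dx\right)^{1/2}$ the energy norm; exact solutions are the weak solutions of finite energy, i.e. $(u,\partial_tu)$ has finite energy at each time and is continuous in $t$ for the energy norm, $\partial_t u$ is the derivative of $u$ in $L^2(c^{-2}dx)$, and $\frac{d}{dt}\int c^{-2}\partial_tu\,\varphi\,dx=\int u\,\Delta\varphi\,dx$ for all $t$ and all $\varphi\in C_c^\infty(\mathbb R^d)$; the Hamiltonians are $H(x,p)=\pm c(x)|p|$; (b) the semiclassical Schrödinger equation $P=-i\varepsilon\partial_t+\sigma\frac{\varepsilon^2}{2}\Delta$, with $\varepsilon=1/k$ and a fixed sign $\sigma\in\{1,-1\}$, and $\|\cdot\|_S$ the $L^2(\mathbb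 R^d)$ norm; exact solutions are the weak solutions in $C(\mathbb R;L^2(\mathbb R^d))$; the Hamiltonian is $H(x,p)=-\sigma|p|^2/2$. Let $J\ni 0$ be an open time interval. A Gaussian beam superposition of order $N$ on $J$ is $$u_{GB}(x,t)=k^{m/2}\int_{K_0}v(x,t;X_0)\,dX_0,$$ where $K_0$ is a measurable set whose closure $\overline{K_0}$ is a compact subset of an embedded smooth $m$-dimensional submanifold of phase space $\mathbb R^d_x\times\mathbb R^d_p$ (and $\overline{K_0}$ does not meet $\{p=0\}$ in case (a)), $dX_0$ is the surface measure, and $v$ is an $N$-th order Gaussian beam (in case (a) the sum of the beams of one or both of the two modes $\pm$) $$v(x,t;X_0)=\sum_{j=0}^{\lceil N/2\rceil-1}k^{-j}\rho_\eta(x-x(t))\,a_j(t,x-x(t))\,e^{ik\phi(t,x-x(t))}.$$ Here $(x(t),p(t))$ solves $\dot x=\partial_pH$, $\dot p=-\partial_xH$ on $J$ with $(x(0),p(0))=X_0$. The functions $\phi(t,y)$ and $a_j(t,y)$ do not depend on $k$, are smooth on $J\times\mathbb R^d$, and they and all their derivatives depend continuously on $X_0\in\overline{K_0}$. On the ray,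 $\phi(t,0)$ is real and $\nabla_y\phi(t,0)=p(t)$. For some $0<\eta\le\infty$, with $\eta=\infty$ allowed only if $N=1$, the cutoff $\rho_\eta\ge0$ is smooth, $\rho_\eta(z)=1$ for $|z|\le\eta$ and $\rho_\eta(z)=0$ for $|z|\ge2\eta$ (so $\rho_\infty=1$), and for some $\delta>0$ one has $\operatorname{Im}\phi(t,y)\ge\delta|y|^2$ for $|y|\le2\eta$, $t\in J$, $X_0\in\overline{K_0}$. If $N=1$, $\phi$ is a quadratic polynomial in $y$ and $a_0$ is independent of $y$. Finally, writing $P\big(\sum_jk^{-j}a_je^{ik\phi}\big)=e^{ik\phi}\sum_jk^{2-j}L_j$ in case (a), and the same with $k^{-j}$ in place of $k^{2-j}$ in case (b), each $L_j$ vanishes to order $N+2-2j$ on the central ray (all its $x$-derivatives of order less than $N+2-2j$ vanish there). Theorem. Let $t_1,t_2\in J$, let $u_{GB}$ (depending on $k\ge1$) be a Gaussian beam superposition with finite norm $\|\cdot\|_S$ at the times $t_1$ and $t_2$, and let $u$ (depending on $k\ge 1$) be an exact solution of $Pu=0$. Assume that for some $\alpha>\beta>0$ and positive constants $C,c_1$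 one has, for all $k\ge1$, $$\|(u-u_{GB})(\cdot,t_1)\|_S\le Ck^{-\alpha}\quad\text{and}\quad\|(u-u_{GB})(\cdot,t_2)\|_S\ge c_1k^{-\beta}.$$ Then there are exact solutions $w_1,w_2$ (depending on $k\ge1$) and constants $c_0>0$, $k_0\ge1$ independent of $k$ such that for all $k\ge k_0$ $$\|(w_1-u_{GB})(\cdot,t_1)\|_S=0\quad\text{and}\quad\|(w_1-u_{GB})(\cdot,t_2)\|_S\ge c_0k^{-\beta},$$ $$\|(w_2-u_{GB})(\cdot,t_1)\|_S\ge c_0k^{-\beta}\quad\text{and}\quad\|(w_2-u_{GB})(\cdot,t_2)\|_S=0.$$ Moreover $w_1$ has the same Cauchy data as $u_{GB}$ at $t_1$, and $w_2$ the same Cauchy data as $u_{GB}$ at $t_2$: $u_{GB}$ and, in case (a), $\partial_tu_{GB}$ agree with those of the solution almost everywhere. -/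

import Mathlib

open MeasureTheory Filter Topology
open scoped ContDiff ENNReal

noncomputable section

/-! ### Space, phase space, submanifolds -/

/-- Physical space `ℝᵈ`. -/
abbrev Space (d : ℕ) : Type := EuclideanSpace ℝ (Fin d)

/-- Phase space `ℝᵈ × ℝᵈ` of pairs `(x, p)`, with its Euclidean metric. -/
abbrev PhaseSpace (d : ℕ) : Type := WithLp 2 (Space d × Space d)

/-- `M` is an embedded smooth `m`-dimensional submanifold of phase space: near each of its points
there is a smooth chart of phase space that straightens `M` to an `m`-dimensional subspace. -/
def IsSmoothSubmanifold {d : ℕ} (m : ℕ) (M : Set (PhaseSpace d)) : Prop :=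
  ∀ X ∈ M, ∃ (e : OpenPartialHomeomorph (PhaseSpace d) (PhaseSpace d))
    (W : Submodule ℝ (PhaseSpace d)),
    X ∈ e.source ∧ ContDiffOn ℝ ∞ e e.source ∧ ContDiffOn ℝ ∞ e.symm e.target ∧
    Module.finrank ℝ W = m ∧ ∀ Y ∈ e.source, Y ∈ M ↔ e Y ∈ W

/-- `K` is a relatively compact measurable piece of an `m`-dimensional submanifold, `m ≤ d`. -/
def IsInitialSet {d : ℕ} (m : ℕ) (K : Set (PhaseSpace d)) : Prop :=
  m ≤ d ∧ MeasurableSet K ∧ IsCompact (closure K) ∧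
    ∃ M : Set (PhaseSpace d), IsSmoothSubmanifold m M ∧ closure K ⊆ M

/-! ### Differential operators on functions of `(t, x)` -/

/-- `∂ₜ f`. -/
def timeDeriv {d : ℕ} (f : ℝ → Space d → ℂ) : ℝ → Space d → ℂ :=
  fun t x => deriv (fun s => f s x) t

/-- `∂ f / ∂ xᵢ` for a function of `x`. -/
def partialDeriv {d : ℕ} (i : Fin d) (f : Space d → ℂ) : Space d → ℂ :=
  fun x => fderiv ℝ f x (EuclideanSpace.single i 1)

/-- The complex bilinear product `∇ₓ f · ∇ₓ g = ∑ᵢ ∂ᵢ f ∂ᵢ g`. -/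
def gradDot {d : ℕ} (f g : ℝ → Space d → ℂ) : ℝ → Space d → ℂ :=
  fun t x => ∑ i, partialDeriv i (f t) x * partialDeriv i (g t) x

/-- `Δₓ f`. -/
def spaceLaplacian {d : ℕ} (f : ℝ → Space d → ℂ) : ℝ → Space d → ℂ :=
  fun t x => Laplacian.laplacian (f t) x

/-- `P f = ∂ₜ² f - c² Δ f`. -/
def waveOp {d : ℕ} (c : Space d → ℝ) (f : ℝ → Space d → ℂ) : ℝ → Space d → ℂ :=
  fun t x => timeDeriv (timeDeriv f) t x - (c x : ℂ) ^ 2 * spaceLaplacian f t x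

/-- The coefficients `L₀, L₁, …` of an expansion in powers of `1 / k` in which the amplitude
`∑ⱼ k⁻ʲ Aⱼ` is acted on by `E + k⁻¹ T + k⁻² Q`, where `E` is multiplication by a function. -/
def wkbCoeff {d : ℕ} (E : ℝ → Space d → ℂ) (T Q : (ℝ → Space d → ℂ) → ℝ → Space d → ℂ)
    (A : ℕ → ℝ → Space d → ℂ) : ℕ → ℝ → Space d → ℂ
  | 0 => fun t x => E t x * A 0 t x
  | 1 => fun t x => E t x * A 1 t x + T (A 0) t x
  | j + 2 => fun t x => E t x * A (j + 2) t x + T (A (j + 1)) t x + Q (A j) t x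

/-- The functions `Lⱼ` with `P (a e^{ikΦ}) = e^{ikΦ} ∑ⱼ k²⁻ʲ Lⱼ`, for `a = ∑ⱼ k⁻ʲ Aⱼ` and
`P = ∂ₜ² - c² Δ`. -/
def waveCoeff {d : ℕ} (c : Space d → ℝ) (Φ : ℝ → Space d → ℂ) (A : ℕ → ℝ → Space d → ℂ) :
    ℕ → ℝ → Space d → ℂ :=
  wkbCoeff
    (fun t x => (c x : ℂ) ^ 2 * gradDot Φ Φ t x - timeDeriv Φ t x ^ 2)
    (fun a t x => Complex.I * (2 * timeDeriv Φ t x * timeDeriv a t x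
      - 2 * (c x : ℂ) ^ 2 * gradDot Φ a t x + waveOp c Φ t x * a t x))
    (waveOp c) A

/-- The functions `Lⱼ` with `P (a e^{ikΦ}) = e^{ikΦ} ∑ⱼ k⁻ʲ Lⱼ`, for `a = ∑ⱼ k⁻ʲ Aⱼ` and
`P = -i ε ∂ₜ + σ (ε² / 2) Δ`, `ε = 1 / k`. -/
def schrodingerCoeff {d : ℕ} (σ : ℤˣ) (Φ : ℝ → Space d → ℂ) (A : ℕ → ℝ → Space d → ℂ) :
    ℕ → ℝ → Space d → ℂ :=
  wkbCoeff
    (fun t x => timeDeriv Φ t x - (σ : ℂ) / 2 * gradDot Φ Φ t x)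
    (fun a t x => Complex.I * (-timeDeriv a t x
      + (σ : ℂ) * (gradDot Φ a t x + 1 / 2 * spaceLaplacian Φ t x * a t x)))
    (fun a t x => (σ : ℂ) / 2 * spaceLaplacian a t x) A

/-- The Hamiltonian `σ c(x) |p|` of a mode `σ = ±1` of the wave equation. -/
def waveHamiltonian {d : ℕ} (c : Space d → ℝ) (σ : ℤˣ) (x p : Space d) : ℝ :=
  (σ : ℝ) * (c x * ‖p‖)

/-- The Hamiltonian `-σ |p|² / 2` of the operator `-i ε ∂ₜ + σ (ε² / 2) Δ`. -/
def schrodingerHamiltonian {d : ℕ} (σ : ℤˣ) (_x p : Space d) : ℝ :=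
  -(σ : ℝ) * (‖p‖ ^ 2 / 2)

/-! ### Gaussian beams and their superpositions -/

/-- The data of a family of beams labelled by their initial points in phase space. Phase and
amplitudes are functions of the time `t` and of the displacement `y` from the central ray. -/
structure BeamFamily (d : ℕ) where
  ray : PhaseSpace d → ℝ → Space d
  momentum : PhaseSpace d → ℝ → Space d
  phase : PhaseSpace d → ℝ → Space d → ℂ
  amp : ℕ → PhaseSpace d → ℝ → Space d → ℂ
  η : ℝ≥0∞
  cutoff : Space d → ℝ

namespace BeamFamily

variable {d : ℕ} (B : BeamFamily d)

/-- The phase as a function of `(t, x)`. -/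
def phaseAt (X : PhaseSpace d) : ℝ → Space d → ℂ := fun t x => B.phase X t (x - B.ray X t)

/-- The `j`-th amplitude as a function of `(t, x)`. -/
def ampAt (X : PhaseSpace d) (j : ℕ) : ℝ → Space d → ℂ := fun t x => B.amp j X t (x - B.ray X t)

/-- The beam `v(x, t; X) = ∑ⱼ k⁻ʲ ρ(x - x(t)) aⱼ(t, x - x(t)) e^{i k φ(t, x - x(t))}`, where `j`
runs from `0` to `⌈N / 2⌉ - 1`. -/
def beam (N : ℕ) (k : ℝ) (X : PhaseSpace d) : ℝ → Space d → ℂ := fun t x =>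
  ∑ j ∈ Finset.range ((N + 1) / 2), ((k : ℂ) ^ j)⁻¹ * (B.cutoff (x - B.ray X t) : ℂ) *
    B.ampAt X j t x * Complex.exp (Complex.I * k * B.phaseAt X t x)

end BeamFamily

/-- A family of functions of `(t, y)`, smooth on `J × ℝᵈ`, all of whose derivatives depend
continuously on the label `X ∈ K`. -/
def IsSmoothFamily {d : ℕ} (K : Set (PhaseSpace d)) (J : Set ℝ)
    (f : PhaseSpace d → ℝ → Space d → ℂ) : Prop :=
  (∀ X ∈ K, ContDiffOn ℝ ∞ (Function.uncurry (f X)) (J ×ˢ Set.univ)) ∧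
  ∀ n : ℕ, ContinuousOn
    (fun q : PhaseSpace d × (ℝ × Space d) => iteratedFDeriv ℝ n (Function.uncurry (f q.1)) q.2)
    (K ×ˢ (J ×ˢ Set.univ))

/-- `B` is a family of `N`-th order Gaussian beams with initial points in `K`, on the time
interval `J`, for the Hamiltonian `H` and the operator whose expansion coefficients are
`L phase amplitudes j`. The value `η = ∞` (no cutoff) is reserved for first order beams. -/
structure IsGaussianBeamFamily {d : ℕ} (B : BeamFamily d) (N : ℕ) (K : Set (PhaseSpace d))
    (J : Set ℝ) (H : Space d → Space d → ℝ)
    (L : (ℝ → Space d → ℂ) → (ℕ → ℝ → Space d → ℂ) → ℕ → ℝ → Space d → ℂ) : Prop where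
  ray_init : ∀ X ∈ K, B.ray X 0 = X.fst ∧ B.momentum X 0 = X.snd
  hasDerivAt_ray : ∀ X ∈ K, ∀ t ∈ J,
    HasDerivAt (B.ray X) (gradient (fun p => H (B.ray X t) p) (B.momentum X t)) t
  hasDerivAt_momentum : ∀ X ∈ K, ∀ t ∈ J,
    HasDerivAt (B.momentum X) (-gradient (fun x => H x (B.momentum X t)) (B.ray X t)) t
  smooth_phase : IsSmoothFamily K J B.phase
  smooth_amp : ∀ j, IsSmoothFamily K J (B.amp j)
  /-- there are `⌈N / 2⌉` amplitudes -/
  amp_eq_zero : ∀ j, (N + 1) / 2 ≤ j → B.amp j = 0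
  /-- on the central ray the phase is real and its gradient is the momentum -/
  phase_real : ∀ X ∈ K, ∀ t ∈ J, (B.phase X t 0).im = 0
  phase_grad : ∀ X ∈ K, ∀ t ∈ J, ∀ y : Space d,
    fderiv ℝ (B.phase X t) 0 y = ((inner ℝ (B.momentum X t) y : ℝ) : ℂ)
  η_pos : 0 < B.η
  η_top : B.η = ⊤ → N = 1
  smooth_cutoff : ContDiff ℝ ∞ B.cutoff
  cutoff_nonneg : ∀ z, 0 ≤ B.cutoff z
  cutoff_one : ∀ z, ‖z‖ₑ ≤ B.η → B.cutoff z = 1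
  cutoff_zero : ∀ z, 2 * B.η ≤ ‖z‖ₑ → B.cutoff z = 0
  /-- Gaussian profile -/
  phase_im : ∃ δ : ℝ, 0 < δ ∧ ∀ X ∈ K, ∀ t ∈ J, ∀ y : Space d, ‖y‖ₑ ≤ 2 * B.η →
    δ * ‖y‖ ^ 2 ≤ (B.phase X t y).im
  /-- first order beams: the phase is quadratic and the amplitude depends on time only -/
  first_order : N = 1 → ∀ X ∈ K, ∀ t ∈ J,
    (∃ M : Matrix (Fin d) (Fin d) ℂ, ∀ y : Space d,
      B.phase X t y = B.phase X t 0 + ((inner ℝ (B.momentum X t) y : ℝ) : ℂ)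
        + 1 / 2 * ∑ i, ∑ j, M i j * (y i : ℂ) * (y j : ℂ)) ∧
    ∀ y : Space d, B.amp 0 X t y = B.amp 0 X t 0
  /-- `Lⱼ` vanishes to order `N + 2 - 2j` on the central ray -/
  coeff_vanish : ∀ X ∈ K, ∀ t ∈ J, ∀ j n : ℕ, n + 2 * j < N + 2 →
    iteratedFDeriv ℝ n (L (B.phaseAt X) (B.ampAt X) j t) (B.ray X t) = 0

/-- `k^{m/2} ∫_K v(x, t; X) dX`, where `dX` is the `m`-dimensional surface measure. -/
def superposition {d : ℕ} (m : ℕ) (K : Set (PhaseSpace d)) (k : ℝ)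
    (v : PhaseSpace d → ℝ → Space d → ℂ) : ℝ → Space d → ℂ := fun t x =>
  ((k ^ ((m : ℝ) / 2) : ℝ) : ℂ) * ∫ X in K, v X t x ∂(Measure.euclideanHausdorffMeasure m)

/-- `uGB k t x` is, for `k ≥ 1` and `t ∈ J`, a superposition over a bounded `m`-dimensional set
`K` of `N`-th order Gaussian beams for the wave equation; one or both of the modes `σ = ±1`
are present, and `K` stays away from `p = 0`. -/
def IsWaveBeamSuperposition {d : ℕ} (c : Space d → ℝ) (N m : ℕ) (J : Set ℝ)
    (uGB : ℝ → ℝ → Space d → ℂ) : Prop :=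
  ∃ (K : Set (PhaseSpace d)) (modes : Finset ℤˣ) (B : ℤˣ → BeamFamily d),
    IsInitialSet m K ∧ (∀ X ∈ closure K, X.snd ≠ 0) ∧
    (∀ σ ∈ modes, IsGaussianBeamFamily (B σ) N (closure K) J (waveHamiltonian c σ)
      (waveCoeff c)) ∧
    ∀ k : ℝ, 1 ≤ k → ∀ t ∈ J, ∀ x,
      uGB k t x = superposition m K k (fun X t x => ∑ σ ∈ modes, (B σ).beam N k X t x) t x

/-- The same for the Schrödinger operator `-i ε ∂ₜ + σ (ε² / 2) Δ`, `ε = 1 / k`. -/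
def IsSchrodingerBeamSuperposition {d : ℕ} (σ : ℤˣ) (N m : ℕ) (J : Set ℝ)
    (uGB : ℝ → ℝ → Space d → ℂ) : Prop :=
  ∃ (K : Set (PhaseSpace d)) (B : BeamFamily d),
    IsInitialSet m K ∧
    IsGaussianBeamFamily B N (closure K) J (schrodingerHamiltonian σ) (schrodingerCoeff σ) ∧
    ∀ k : ℝ, 1 ≤ k → ∀ t ∈ J, ∀ x, uGB k t x = superposition m K k (B.beam N k) t x

/-! ### Energy norm and exact solutions -/

/-- `G` is the weak gradient of `f`. -/
def HasWeakGradient {d : ℕ} (f : Space d → ℂ) (G : Space d → EuclideanSpace ℂ (Fin d)) : Prop :=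
  LocallyIntegrable f volume ∧ LocallyIntegrable G volume ∧
  ∀ φ : Space d → ℂ, ContDiff ℝ ∞ φ → HasCompactSupport φ → ∀ i : Fin d,
    ∫ x, f x * partialDeriv i φ x = -∫ x, G x i * φ x

/-- The energy norm `(½ ∫ c⁻² |g|² + |∇f|²)^{1/2}` of a state `(f, g) = (u, ∂ₜ u)`. It is `∞` when
`f` has no weak gradient or `g` is not measurable; the infimum is over the weak gradients of `f`,
which agree almost everywhere. -/
def energyNorm {d : ℕ} (c : Space d → ℝ) (f g : Space d → ℂ) : ℝ≥0∞ :=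
  ⨅ (G : Space d → EuclideanSpace ℂ (Fin d)) (_ : HasWeakGradient f G)
    (_ : AEStronglyMeasurable g volume),
    (2⁻¹ * ∫⁻ x, (ENNReal.ofReal ((c x ^ 2)⁻¹) * ‖g x‖ₑ ^ 2 + ‖G x‖ₑ ^ 2)) ^ (1 / 2 : ℝ)

/-- `u` is a finite energy (weak) solution of `∂ₜ² u = c² Δ u` on `ℝ × ℝᵈ`, and `ut` is its time
derivative: the state `(u, ut)` is continuous in time for the energy norm, `ut` is the derivative
of `u` in the space `L²(c⁻² dx)`, and `d/dt ∫ c⁻² ut φ = ∫ u Δφ` for all test functions `φ`. -/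
structure IsWaveSolution {d : ℕ} (c : Space d → ℝ) (u ut : ℝ → Space d → ℂ) : Prop where
  finite_energy : ∀ t, energyNorm c (u t) (ut t) ≠ ⊤
  continuous : ∀ t, Tendsto (fun s => energyNorm c (u s - u t) (ut s - ut t)) (𝓝 t) (𝓝 0)
  timeDerivative : ∀ t, Tendsto
    (fun h : ℝ => ∫⁻ x, ENNReal.ofReal ((c x ^ 2)⁻¹) *
      ‖(u (t + h) x - u t x) / (h : ℂ) - ut t x‖ₑ ^ 2) (𝓝[≠] 0) (𝓝 0)
  equation : ∀ φ : Space d → ℂ, ContDiff ℝ ∞ φ → HasCompactSupport φ → ∀ t,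
    HasDerivAt (fun s => ∫ x, ((c x : ℂ) ^ 2)⁻¹ * ut s x * φ x)
      (∫ x, u t x * Laplacian.laplacian φ x) t

/-- `u` is an `L²` (weak) solution of `-i ε ∂ₜ u + σ (ε² / 2) Δ u = 0`, `ε = 1 / k`, on `ℝ × ℝᵈ`. -/
structure IsSchrodingerSolution {d : ℕ} (σ : ℤˣ) (k : ℝ) (u : ℝ → Space d → ℂ) : Prop where
  memLp : ∀ t, MemLp (u t) 2 volume
  continuous : ∀ t, Tendsto (fun s => eLpNorm (u s - u t) 2 volume) (𝓝 t) (𝓝 0)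
  equation : ∀ φ : Space d → ℂ, ContDiff ℝ ∞ φ → HasCompactSupport φ → ∀ t,
    ∃ D : ℂ, HasDerivAt (fun s => ∫ x, u s x * φ x) D t ∧
      -Complex.I * (1 / (k : ℂ)) * D
        + (σ : ℂ) * ((1 / (k : ℂ)) ^ 2 / 2) * ∫ x, u t x * Laplacian.laplacian φ x = 0

end

noncomputable section

/-! ### Unitary groups from Cayley transforms -/

/-! The argument is a correction by linearity. Let `z` be an exact solution with the Cauchy data of
`uGB - u` at `t₁`; then `w₁ = u + z` has the data of `uGB` at `t₁`. The norm of `z` is conserved, so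
at `t₂` it is still at most `C₁ k^{-α}`, which is negligible against the error `c₁ k^{-β}` of `u`
since `α > β`. The reverse triangle inequality leaves half of that error (`exists_threshold`).
Correcting at `t₂` instead gives `w₂`: the corrector carries the large error back to `t₁`
undiminished, and there the error of `u` is the small perturbation.

The work lies in producing a norm-preserving solution for arbitrary data of finite norm, without any
growth condition on `c`: `exists_isWaveSolution` and `exists_isSchrodingerSolution`. Both come from
a unitary group `e^{tA}` with `A` skew-adjoint. To handle bounded operators only, `A` is encoded by
its Cayley transform `W = (1 + A) / (1 - A)`, a unitary without eigenvalue `-1`. The continuous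
functional calculus of `W` defines `(1 + W) e^{tA}`, the factor `1 + w` removing the discontinuity
at `w = -1`, and `e^{tA}` follows by density of the range of `1 + W`. Since `e^{tA} x` need not be
differentiable, the equation is obtained weakly, by pairing with vectors in the domain of `A²`
(`hasDerivAt_inner_cayleyGroup`); test functions supply such vectors.

For the wave equation, `D` is the closure of `φ / c ↦ ∇φ` and `A (g, G) = (-D* G, D g)` acts on
states `(∂ₜu / c, ∇u)`, whose `L²` norm is the energy norm up to the factor `√2`. The Cayley
transform of `A` is a product of two reflections, hence visibly unitary. For the Schrödinger
equation `c = 1` and `A = i D* D`; the resolvent `(1 + D* D)⁻¹` is read off the orthogonal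
projection onto the graph of `D`, and time is rescaled by `σ / (2k)`. -/

/-- `(1 + w) e^{t (w - 1) / (w + 1)}`. -/
def cayleyExp (t : ℝ) (w : ℂ) : ℂ := (1 + w) * Complex.exp (t * ((w - 1) / (w + 1)))

/-- The Cayley map sends the circle to the imaginary axis. The bound is `|w - 1| ≤ 2`: one factor `1
+ w` absorbs one power of the unbounded `θ`. At `w = -1` division by zero gives `θ = 0`. -/
lemma cayley_eq_I_mul {w : ℂ} (hw : ‖w‖ = 1) :
    ∃ θ : ℝ, (w - 1) / (w + 1) = Complex.I * θ ∧ |θ| * ‖1 + w‖ ≤ 2 := by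
  by_cases h : w + 1 = 0
  · exact ⟨0, by simp [h]⟩
  have hre : ((w - 1) / (w + 1)).re = 0 := by
    have : w.re * w.re + w.im * w.im = 1 := by
      have := Complex.normSq_eq_norm_sq w
      rw [Complex.normSq_apply, hw] at this
      simpa using this
    rw [Complex.div_re, ← add_div, div_eq_zero_iff]
    left
    simp
    linear_combination this
  refine ⟨((w - 1) / (w + 1)).im, ?_, ?_⟩
  · apply Complex.ext <;> simp [hre]
  · have hn : |((w - 1) / (w + 1)).im| ≤ ‖w - 1‖ / ‖w + 1‖ := by
      rw [← norm_div]; exact Complex.abs_im_le_norm _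
    have h0 : 0 < ‖w + 1‖ := norm_pos_iff.2 h
    rw [add_comm 1 w]
    calc _ ≤ ‖w - 1‖ / ‖w + 1‖ * ‖w + 1‖ := by gcongr
      _ = ‖w - 1‖ := by field_simp
      _ ≤ ‖w‖ + ‖(1 : ℂ)‖ := norm_sub_le _ _
      _ = 2 := by rw [hw]; norm_num

/-- A Taylor bound valid for all `a`, as `θ` is unbounded; for `|a| > 1` the trivial bound `2 + |a|`
suffices. -/
lemma norm_exp_I_sub_le (a : ℝ) : ‖Complex.exp (Complex.I * a) - 1 - Complex.I * a‖ ≤ 3 * a ^ 2 := by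
  rcases le_or_gt |a| 1 with h | h
  · have := Complex.norm_exp_sub_one_sub_id_le (x := Complex.I * a) (by simpa using h)
    simp at this
    nlinarith [sq_nonneg a]
  · have h1 : ‖Complex.exp (Complex.I * a)‖ = 1 := by
      rw [mul_comm]; exact Complex.norm_exp_ofReal_mul_I a
    have h2 : ‖Complex.exp (Complex.I * a) - 1 - Complex.I * a‖ ≤ 1 + 1 + |a| := by
      refine (norm_sub_le _ _).trans (add_le_add ((norm_sub_le _ _).trans ?_) ?_)
      · rw [h1]; simp
      · simp
    nlinarith [sq_abs a]

lemma norm_cayleyExp {t : ℝ} {w : ℂ} (hw : ‖w‖ = 1) : ‖cayleyExp t w‖ = ‖1 + w‖ := by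
  obtain ⟨θ, h, -⟩ := cayley_eq_I_mul hw
  rw [cayleyExp, h, norm_mul, show (t : ℂ) * (Complex.I * θ) = (t * θ : ℝ) * Complex.I by
    push_cast; ring, Complex.norm_exp_ofReal_mul_I, mul_one]

lemma cayleyExp_eq {t θ : ℝ} {w : ℂ} (h : (w - 1) / (w + 1) = Complex.I * θ) :
    cayleyExp t w = (1 + w) * Complex.exp (Complex.I * (t * θ : ℝ)) := by
  rw [cayleyExp, h]; congr 2; push_cast; ring

lemma norm_cayleyExp_sub_le {s t : ℝ} {w : ℂ} (hw : ‖w‖ = 1) :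
    ‖cayleyExp t w - cayleyExp s w‖ ≤ 2 * |t - s| := by
  obtain ⟨θ, h, hb⟩ := cayley_eq_I_mul hw
  have : cayleyExp t w - cayleyExp s w = (1 + w) * Complex.exp ((s * θ : ℝ) * Complex.I) *
      (Complex.exp (Complex.I * ((t - s) * θ : ℝ)) - 1) := by
    rw [cayleyExp_eq h, cayleyExp_eq h, mul_sub, mul_assoc, ← Complex.exp_add, mul_comm _ Complex.I]
    push_cast; ring_nf
  rw [this, norm_mul, norm_mul, Complex.norm_exp_ofReal_mul_I, mul_one]
  calc _ ≤ ‖1 + w‖ * ‖(t - s) * θ‖ := by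
        gcongr; exact Real.norm_exp_I_mul_ofReal_sub_one_le
    _ = (|θ| * ‖1 + w‖) * |t - s| := by rw [norm_mul, Real.norm_eq_abs, Real.norm_eq_abs]; ring
    _ ≤ _ := by gcongr

/-- The remainder is quadratic in `θ`, so a second factor `1 + w` is needed to make it uniform on
the circle; `12 = 3 · 2²`. -/
lemma norm_cayleyExp_taylor_le {s t : ℝ} {w : ℂ} (hw : ‖w‖ = 1) :
    ‖cayleyExp t w * (1 + w) - cayleyExp s w * (1 + w) - ((t - s : ℝ) : ℂ) * (cayleyExp s w * (w - 1))‖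
      ≤ 12 * |t - s| ^ 2 := by
  obtain ⟨θ, h, hb⟩ := cayley_eq_I_mul hw
  have hw1 : (1 + w) * (w - 1) = (1 + w) * ((1 + w) * (Complex.I * θ)) := by
    by_cases h0 : w + 1 = 0
    · rw [add_comm 1 w, h0]; simp
    · rw [← h, add_comm 1 w]; field_simp
  have : cayleyExp t w * (1 + w) - cayleyExp s w * (1 + w) -
      ((t - s : ℝ) : ℂ) * (cayleyExp s w * (w - 1)) =
      (1 + w) ^ 2 * Complex.exp ((s * θ : ℝ) * Complex.I) *
      (Complex.exp (Complex.I * ((t - s) * θ : ℝ)) - 1 - Complex.I * ((t - s) * θ : ℝ)) := by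
    have e : Complex.exp (Complex.I * (t * θ : ℝ)) = Complex.exp (Complex.I * (s * θ : ℝ)) *
        Complex.exp (Complex.I * ((t - s) * θ : ℝ)) := by
      rw [← Complex.exp_add]; push_cast; ring_nf
    rw [cayleyExp_eq h, cayleyExp_eq h, e, mul_comm _ Complex.I]
    push_cast
    linear_combination (-(t - s) * Complex.exp (Complex.I * (s * θ))) * hw1
  rw [this, norm_mul, norm_mul, Complex.norm_exp_ofReal_mul_I, mul_one, norm_pow]
  calc _ ≤ ‖1 + w‖ ^ 2 * (3 * ((t - s) * θ) ^ 2) := by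
        gcongr; exact norm_exp_I_sub_le _
    _ = 3 * (|θ| * ‖1 + w‖) ^ 2 * |t - s| ^ 2 := by
        rw [mul_pow, mul_pow, sq_abs, sq_abs]; ring
    _ ≤ 3 * 2 ^ 2 * |t - s| ^ 2 := by gcongr
    _ = _ := by ring

/-- The exponential oscillates near `w = -1`, but on the circle it has modulus one, so the factor `1
+ w` forces the limit `0`. -/
lemma continuousOn_cayleyExp (t : ℝ) : ContinuousOn (cayleyExp t) (Metric.sphere 0 1) := by
  intro w hw
  by_cases h : w + 1 = 0
  · have h1 : 1 + w = 0 := by rw [add_comm, h]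
    have : cayleyExp t w = 0 := by simp [cayleyExp, h1]
    rw [ContinuousWithinAt, this, tendsto_zero_iff_norm_tendsto_zero]
    have hc : Tendsto (fun z : ℂ => ‖1 + z‖) (𝓝[Metric.sphere 0 1] w) (𝓝 0) := by
      have : Continuous fun z : ℂ => ‖1 + z‖ := by fun_prop
      simpa [h1] using (this.tendsto w).mono_left nhdsWithin_le_nhds
    refine hc.congr' ?_
    filter_upwards [self_mem_nhdsWithin] with z hz
    rw [norm_cayleyExp (by simpa using hz)]
  · apply ContinuousAt.continuousWithinAt
    unfold cayleyExp
    fun_prop (disch := exact h)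

variable {𝓗 : Type*} [NormedAddCommGroup 𝓗] [InnerProductSpace ℂ 𝓗] [CompleteSpace 𝓗]

/-- The operator `(1 + W) e^{t (W - 1) / (W + 1)}` of a unitary `W`. -/
def cayleyOp (W : 𝓗 →L[ℂ] 𝓗) (t : ℝ) : 𝓗 →L[ℂ] 𝓗 := cfc (cayleyExp t) W

/-! ### The one-parameter group of a unitary operator without eigenvalue `-1`. -/

section Cayley

variable {W : 𝓗 →L[ℂ] 𝓗}

lemma norm_eq_one_of_mem_spectrum (hW : W ∈ unitary (𝓗 →L[ℂ] 𝓗)) {w : ℂ}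
    (hw : w ∈ spectrum ℂ W) : ‖w‖ = 1 := by
  simpa using spectrum.subset_circle_of_unitary hW hw

lemma continuousOn_cayleyExp_spectrum (hW : W ∈ unitary (𝓗 →L[ℂ] 𝓗)) (t : ℝ) :
    ContinuousOn (cayleyExp t) (spectrum ℂ W) :=
  (continuousOn_cayleyExp t).mono (spectrum.subset_circle_of_unitary hW)

lemma cayleyOp_zero (hW : W ∈ unitary (𝓗 →L[ℂ] 𝓗)) : cayleyOp W 0 = 1 + W := by
  have := isStarNormal_of_mem_unitary hW
  have h : cayleyExp 0 = fun w => 1 + w := by ext; simp [cayleyExp]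
  rw [cayleyOp, h, cfc_const_add 1 (fun w => w) W, cfc_id' ℂ W, map_one]

/-- Unitarity and the group law in one identity: on the spectrum the exponents are imaginary, so
conjugation reverses time and only `s + t - r` matters. -/
lemma star_cayleyOp_mul_cayleyOp (hW : W ∈ unitary (𝓗 →L[ℂ] 𝓗)) (r s t : ℝ) :
    star (cayleyOp W r) * cayleyOp W (s + t) = star (cayleyOp W (r - s)) * cayleyOp W t := by
  have := isStarNormal_of_mem_unitary hW
  have c := fun t => continuousOn_cayleyExp_spectrum hW t
  simp only [cayleyOp, ← cfc_star]
  rw [← cfc_mul _ _ _ (c _).star (c _), ← cfc_mul _ _ _ (c _).star (c _)]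
  refine cfc_congr fun w hw => ?_
  obtain ⟨θ, h, -⟩ := cayley_eq_I_mul (norm_eq_one_of_mem_spectrum hW hw)
  simp only [cayleyExp, h, RCLike.star_def, map_mul, ← Complex.exp_conj, Complex.conj_I,
    Complex.conj_ofReal]
  rw [mul_mul_mul_comm, ← Complex.exp_add, mul_mul_mul_comm, ← Complex.exp_add]
  push_cast; ring_nf

lemma inner_cayleyOp_cayleyOp (hW : W ∈ unitary (𝓗 →L[ℂ] 𝓗)) (r s t : ℝ) (x y : 𝓗) :
    inner ℂ (cayleyOp W r x) (cayleyOp W (s + t) y) =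
      inner ℂ (cayleyOp W (r - s) x) (cayleyOp W t y) := by
  have h := congrArg (fun T : 𝓗 →L[ℂ] 𝓗 => inner ℂ x (T y)) (star_cayleyOp_mul_cayleyOp hW r s t)
  simpa [ContinuousLinearMap.star_eq_adjoint, ContinuousLinearMap.adjoint_inner_right] using h

lemma norm_cayleyOp_apply (hW : W ∈ unitary (𝓗 →L[ℂ] 𝓗)) (t : ℝ) (x : 𝓗) :
    ‖cayleyOp W t x‖ = ‖(1 + W) x‖ := by
  have h := inner_cayleyOp_cayleyOp hW t t 0 x x
  rw [add_zero, sub_self, cayleyOp_zero hW, inner_self_eq_norm_sq_to_K,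
    inner_self_eq_norm_sq_to_K] at h
  exact (sq_eq_sq₀ (norm_nonneg _) (norm_nonneg _)).1 (by exact_mod_cast h)

lemma norm_cayleyOp_sub_le (hW : W ∈ unitary (𝓗 →L[ℂ] 𝓗)) (s t : ℝ) :
    ‖cayleyOp W t - cayleyOp W s‖ ≤ 2 * |t - s| := by
  have := isStarNormal_of_mem_unitary hW
  have c := fun t => continuousOn_cayleyExp_spectrum hW t
  rw [cayleyOp, cayleyOp, ← cfc_sub _ _ _ (c _) (c _)]
  exact norm_cfc_le (by positivity) fun w hw =>
    norm_cayleyExp_sub_le (norm_eq_one_of_mem_spectrum hW hw)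

lemma hasDerivAt_cayleyOp (hW : W ∈ unitary (𝓗 →L[ℂ] 𝓗)) (s : ℝ) :
    HasDerivAt (fun t => cayleyOp W t * (1 + W)) (cayleyOp W s * (W - 1)) s := by
  have := isStarNormal_of_mem_unitary hW
  have c := fun t => continuousOn_cayleyExp_spectrum hW t
  have c1 : ContinuousOn (fun w : ℂ => 1 + w) (spectrum ℂ W) := by fun_prop
  have c2 : ContinuousOn (fun w : ℂ => w - 1) (spectrum ℂ W) := by fun_prop
  have e1 : 1 + W = cfc (fun w : ℂ => 1 + w) W := by
    rw [cfc_const_add 1 (fun w => w) W, cfc_id' ℂ W, map_one]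
  have e2 : W - 1 = cfc (fun w : ℂ => w - 1) W := by
    rw [cfc_sub (fun w : ℂ => w) (fun _ => 1) W, cfc_id' ℂ W, cfc_const_one ℂ W]
  rw [hasDerivAt_iff_isLittleO]
  refine Asymptotics.IsBigO.trans_isLittleO (g := fun t => |t - s| ^ 2)
    (Asymptotics.IsBigO.of_bound 12 (Eventually.of_forall fun t => ?_)) ?_
  · rw [e1, e2, cayleyOp, cayleyOp, ← cfc_mul _ _ _ (c _) c1, ← cfc_mul _ _ _ (c _) c1,
      ← cfc_mul _ _ _ (c _) c2,
      show (t - s) • cfc (fun x => cayleyExp s x * (x - 1)) W =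
        ((t - s : ℝ) : ℂ) • cfc (fun x => cayleyExp s x * (x - 1)) W from
        (Complex.coe_smul _ _).symm,
      ← cfc_const_mul ((t - s : ℝ) : ℂ) (fun x => cayleyExp s x * (x - 1)) W ((c s).mul c2),
      ← cfc_sub (fun x => cayleyExp t x * (1 + x)) (fun x => cayleyExp s x * (1 + x)) W
        ((c t).mul c1) ((c s).mul c1),
      ← cfc_sub (fun x => cayleyExp t x * (1 + x) - cayleyExp s x * (1 + x))
        (fun x => ((t - s : ℝ) : ℂ) * (cayleyExp s x * (x - 1))) W
        (((c t).mul c1).sub ((c s).mul c1)) (continuousOn_const.mul ((c s).mul c2))]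
    refine norm_cfc_le (by positivity) fun w hw => ?_
    simpa using norm_cayleyExp_taylor_le (s := s) (t := t) (norm_eq_one_of_mem_spectrum hW hw)
  · simp only [sq]
    have : Tendsto (fun t : ℝ => t - s) (𝓝 s) (𝓝 0) := by
      simpa using (continuous_id.sub continuous_const).tendsto (x := s) (f := fun t : ℝ => t - s)
    simpa using (Asymptotics.isBigO_refl (fun t : ℝ => t - s) (𝓝 s)).mul_isLittleO
      ((Asymptotics.isLittleO_one_iff ℝ).2 this)

/-- The orthogonal complement of the range is the kernel of `1 + W*`, which for unitary `W` is the
kernel of `1 + W`. -/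
lemma denseRange_one_add (hW : W ∈ unitary (𝓗 →L[ℂ] 𝓗)) (hker : ∀ x, W x = -x → x = 0) :
    DenseRange (1 + W : 𝓗 →L[ℂ] 𝓗) := by
  have h : (LinearMap.range (1 + W : 𝓗 →L[ℂ] 𝓗).toLinearMap).topologicalClosure = ⊤ := by
    rw [Submodule.topologicalClosure_eq_top_iff, Submodule.eq_bot_iff]
    intro x hx
    apply hker
    have h1 : star W x = -x := by
      rw [eq_neg_iff_add_eq_zero, ← inner_self_eq_zero (𝕜 := ℂ)]
      have := hx ((1 + W) (star W x + x)) ⟨_, rfl⟩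
      simp only [add_apply, one_apply_eq_self, inner_add_left]
        at this
      rw [inner_add_right, add_comm, ContinuousLinearMap.star_eq_adjoint,
        ContinuousLinearMap.adjoint_inner_right]
      simpa [inner_add_left, ContinuousLinearMap.star_eq_adjoint] using this
    have h2 := congrArg W h1
    have h3 : W (star W x) = x := by
      rw [← mul_apply_eq_comp, Unitary.mul_star_self_of_mem hW,
        one_apply_eq_self]
    rw [h3, map_neg] at h2
    exact neg_eq_iff_eq_neg.1 h2.symm
  rw [DenseRange, dense_iff_closure_eq]
  exact congrArg (fun S : Submodule ℂ 𝓗 => (S : Set 𝓗)) h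

/-- The unitary group `e^{t A}` of the skew-adjoint operator `A = (W - 1) / (W + 1)`. -/
def cayleyGroup (W : 𝓗 →L[ℂ] 𝓗) (t : ℝ) : 𝓗 →L[ℂ] 𝓗 :=
  (cayleyOp W t).toLinearMap.extendOfNorm (1 + W).toLinearMap

lemma cayleyGroup_apply_one_add (hW : W ∈ unitary (𝓗 →L[ℂ] 𝓗)) (hker : ∀ x, W x = -x → x = 0)
    (t : ℝ) (z : 𝓗) : cayleyGroup W t ((1 + W) z) = cayleyOp W t z :=
  LinearMap.extendOfNorm_eq (f := (cayleyOp W t).toLinearMap) (e := (1 + W).toLinearMap)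
    (denseRange_one_add hW hker)
    ⟨1, fun x => by simpa using (norm_cayleyOp_apply hW t x).le⟩ z

lemma norm_cayleyGroup_apply (hW : W ∈ unitary (𝓗 →L[ℂ] 𝓗)) (hker : ∀ x, W x = -x → x = 0)
    (t : ℝ) (x : 𝓗) : ‖cayleyGroup W t x‖ = ‖x‖ :=
  (denseRange_one_add hW hker).induction_on (p := fun x => ‖cayleyGroup W t x‖ = ‖x‖) x
    (isClosed_eq (by fun_prop) (by fun_prop)) fun z => by
      rw [cayleyGroup_apply_one_add hW hker, norm_cayleyOp_apply hW]

lemma cayleyGroup_zero (hW : W ∈ unitary (𝓗 →L[ℂ] 𝓗)) (hker : ∀ x, W x = -x → x = 0)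
    (x : 𝓗) : cayleyGroup W 0 x = x :=
  (denseRange_one_add hW hker).induction_on (p := fun x => cayleyGroup W 0 x = x) x
    (isClosed_eq (by fun_prop) (by fun_prop)) fun z => by
      rw [cayleyGroup_apply_one_add hW hker, cayleyOp_zero hW]

/-- Orbits starting in the range of `1 + W` are Lipschitz; by isometry they approximate every orbit
uniformly in time. -/
lemma continuous_cayleyGroup (hW : W ∈ unitary (𝓗 →L[ℂ] 𝓗)) (hker : ∀ x, W x = -x → x = 0)
    (x : 𝓗) : Continuous fun t => cayleyGroup W t x := by
  refine continuous_of_uniform_approx_of_continuous fun u hu => ?_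
  obtain ⟨ε, hε, hεu⟩ := Metric.mem_uniformity_dist.1 hu
  obtain ⟨z, hz⟩ := (denseRange_one_add hW hker).exists_dist_lt x hε
  refine ⟨fun t => cayleyOp W t z, ?_, fun t => hεu ?_⟩
  · have : Continuous fun t => cayleyOp W t := by
      refine (LipschitzWith.of_dist_le_mul (K := 2) fun s t => ?_).continuous
      rw [dist_eq_norm]
      simpa [Real.dist_eq] using norm_cayleyOp_sub_le hW t s
    fun_prop
  · change dist _ (cayleyOp W t z) < ε
    rw [← cayleyGroup_apply_one_add hW hker, dist_eq_norm, ← map_sub,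
      norm_cayleyGroup_apply hW hker, ← dist_eq_norm]
    exact hz

/-- Moves the evolution, with time reversed, onto the test vector, so that no regularity of `x` is
needed to differentiate. -/
lemma inner_cayleyGroup (hW : W ∈ unitary (𝓗 →L[ℂ] 𝓗)) (hker : ∀ x, W x = -x → x = 0)
    (t : ℝ) (z x : 𝓗) :
    inner ℂ ((1 + W) z) (cayleyGroup W t x) = inner ℂ (cayleyOp W (-t) z) x :=
  (denseRange_one_add hW hker).induction_on
    (p := fun x => inner ℂ ((1 + W) z) (cayleyGroup W t x) = inner ℂ (cayleyOp W (-t) z) x) x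
    (isClosed_eq (by fun_prop) (by fun_prop)) fun y => by
      rw [cayleyGroup_apply_one_add hW hker]
      have := inner_cayleyOp_cayleyOp hW 0 t 0 z y
      rwa [add_zero, zero_sub, cayleyOp_zero hW] at this

/-- Here `W (y - y') = y + y'` says that `y' = A y`. -/
lemma hasDerivAt_inner_cayleyGroup (hW : W ∈ unitary (𝓗 →L[ℂ] 𝓗)) (hker : ∀ x, W x = -x → x = 0)
    {y y' y'' : 𝓗} (h : W (y - y') = y + y') (h' : W (y' - y'') = y' + y'') (x : 𝓗) (t : ℝ) :
    HasDerivAt (fun t => inner ℂ y (cayleyGroup W t x)) (-inner ℂ y' (cayleyGroup W t x)) t := by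
  -- The two hypotheses place `y` in the domain of `A²`, the range of `(1 + W)²`: explicitly `y = (1
  -- + W)² (v / 2)`. One factor passes to `cayleyOp`, the other gives differentiability in operator
  -- norm.
  set v : 𝓗 := (2⁻¹ : ℂ) • ((y - y') - (y' - y'')) with hv
  have hz : (2⁻¹ : ℂ) • (y - y') = (1 + W) ((2⁻¹ : ℂ) • v) := by
    simp only [hv, add_apply, one_apply_eq_self, map_smul, map_sub W (y - y'), h, h']
    module
  have hy : y = (1 + W) ((2⁻¹ : ℂ) • (y - y')) := by
    simp only [add_apply, one_apply_eq_self, map_smul]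
    rw [h]; module
  have hy' : y' = (W - 1) ((2⁻¹ : ℂ) • (y - y')) := by
    simp only [sub_apply, one_apply_eq_self, map_smul]
    rw [h]; module
  have hd := ((((ContinuousLinearMap.apply ℂ 𝓗 ((2⁻¹ : ℂ) • v)).restrictScalars ℝ).hasFDerivAt
    (x := cayleyOp W (-t) * (1 + W))).comp_hasDerivAt t
    ((hasDerivAt_cayleyOp hW (-t)).scomp t (hasDerivAt_neg t))).inner ℂ (hasDerivAt_const t x)
  have e : (fun t => inner ℂ y (cayleyGroup W t x)) = fun t =>
      inner ℂ ((cayleyOp W (-t) * (1 + W)) ((2⁻¹ : ℂ) • v)) x := by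
    ext t
    conv_lhs => rw [hy, inner_cayleyGroup hW hker, hz]
    rfl
  have e' : inner ℂ y' (cayleyGroup W t x) =
      inner ℂ ((cayleyOp W (-t) * (W - 1)) ((2⁻¹ : ℂ) • v)) x := by
    have hc : y' = (1 + W) ((W - 1) ((2⁻¹ : ℂ) • v)) := by
      rw [hy', hz]
      simp only [sub_apply, add_apply,
        one_apply_eq_self, map_sub, map_add]
      abel
    rw [hc, inner_cayleyGroup hW hker]
    rfl
  rw [e, e']
  refine HasDerivAt.congr_deriv hd ?_
  rw [inner_zero_right, zero_add, neg_one_smul, map_neg, inner_neg_left]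
  rfl

end Cayley

end

noncomputable section

/-! ### The Cayley transform attached to the graph of a closed operator -/

section Graph

variable {F E : Type*} [NormedAddCommGroup F] [InnerProductSpace ℂ F]
  [NormedAddCommGroup E] [InnerProductSpace ℂ E]

/-- If `Γ ⊆ F × E` is the graph of `D`, this is the Cayley transform of the skew-adjoint operator
`(g, G) ↦ (-D* G, D g)`: the reflection in the second factor followed by the one in `Γ`. -/
def graphCayley (Γ : Submodule ℂ (WithLp 2 (F × E))) [Γ.HasOrthogonalProjection] :
    WithLp 2 (F × E) →L[ℂ] WithLp 2 (F × E) :=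
  ((LinearIsometryEquiv.withLpProdCongr 2 (LinearIsometryEquiv.refl ℂ F)
    (LinearIsometryEquiv.neg ℂ)).trans Γ.reflection : WithLp 2 (F × E) ≃ₗᵢ[ℂ] WithLp 2 (F × E))

variable (Γ : Submodule ℂ (WithLp 2 (F × E))) [Γ.HasOrthogonalProjection]

lemma graphCayley_mem_unitary [CompleteSpace F] [CompleteSpace E] :
    graphCayley Γ ∈ unitary (WithLp 2 (F × E) →L[ℂ] WithLp 2 (F × E)) :=
  (Unitary.linearIsometryEquiv.symm _).2

lemma graphCayley_apply (h : F) (G : E) :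
    graphCayley Γ (WithLp.toLp 2 (h, G)) = Γ.reflection (WithLp.toLp 2 (h, -G)) := rfl

variable {Γ}

/-- The hypotheses read `K = D g` and `k = -D* G`, that is `(k, K) = A (g, G)`. After the sign
change the argument is `(g, K) - (k, G)`, whose two parts lie in `Γ` and `Γᗮ`. -/
lemma graphCayley_sub {g k : F} {G K : E} (h1 : WithLp.toLp 2 (g, K) ∈ Γ)
    (h2 : WithLp.toLp 2 (k, G) ∈ Γᗮ) :
    graphCayley Γ (WithLp.toLp 2 (g, G) - WithLp.toLp 2 (k, K)) =
      WithLp.toLp 2 (g, G) + WithLp.toLp 2 (k, K) := by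
  have e : WithLp.toLp 2 (g - k, -(G - K)) = WithLp.toLp 2 (g, K) - WithLp.toLp 2 (k, G) := by
    rw [← WithLp.toLp_sub, Prod.mk_sub_mk, neg_sub]
  rw [← WithLp.toLp_sub, Prod.mk_sub_mk, graphCayley_apply, e, map_sub,
    Submodule.reflection_mem_subspace_eq_self h1,
    Submodule.reflection_mem_subspace_orthogonalComplement_eq_neg h2, sub_neg_eq_add,
    ← WithLp.toLp_add, ← WithLp.toLp_add, Prod.mk_add_mk, Prod.mk_add_mk, add_comm K G]

/-- The eigenvalue equation says that `(h, G)` projects onto `Γ` as `(0, G)`. Then `G = 0` because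
`Γ` is a graph, and `h = 0` because the domain of `D` is dense. -/
lemma eq_zero_of_graphCayley_eq_neg (hclos : ∀ G : E, WithLp.toLp 2 ((0 : F), G) ∈ Γ → G = 0)
    (hdense : ∀ h : F, WithLp.toLp 2 (h, (0 : E)) ∈ Γᗮ → h = 0) (x : WithLp 2 (F × E))
    (hx : graphCayley Γ x = -x) : x = 0 := by
  obtain ⟨⟨h, G⟩⟩ := x
  rw [graphCayley_apply] at hx
  have h1 := congrArg Γ.reflection hx
  rw [Submodule.reflection_reflection, map_neg, Submodule.reflection_apply] at h1
  have h2 : Γ.starProjection (WithLp.toLp 2 (h, G)) = WithLp.toLp 2 (0, G) := by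
    have e : (2 : ℂ) • Γ.starProjection (WithLp.toLp 2 (h, G)) =
        (2 : ℂ) • WithLp.toLp 2 ((0 : F), G) := by
      have e1 : WithLp.toLp 2 (h, -G) = WithLp.toLp 2 (h, G) - (2 : ℂ) • WithLp.toLp 2 ((0 : F), G) := by
        rw [← WithLp.toLp_smul, ← WithLp.toLp_sub]
        congr 1
        ext
        · simp
        · simp [two_smul]
      rw [e1] at h1
      rw [two_smul ℂ (Γ.starProjection _), ← two_nsmul]
      have := congrArg (fun z => WithLp.toLp 2 (h, G) - z) h1
      simpa using this.symm
    exact smul_right_injective _ (two_ne_zero) e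
  have hG : G = 0 := hclos G (h2 ▸ Submodule.starProjection_apply_mem Γ _)
  have hh : h = 0 := by
    apply hdense
    have := Submodule.sub_starProjection_mem_orthogonal (K := Γ) (WithLp.toLp 2 (h, G))
    rw [h2] at this
    simpa [← WithLp.toLp_sub] using this
  rw [hG, hh]
  rfl

end Graph

/-! ### Test functions -/

variable {d : ℕ}

/-- `φ ∈ C_c^∞(ℝᵈ)`. -/
structure IsTest (φ : Space d → ℂ) : Prop where
  contDiff : ContDiff ℝ ∞ φ
  hasCompactSupport : HasCompactSupport φ

namespace IsTest

variable {φ ψ : Space d → ℂ}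

lemma add (h : IsTest φ) (h' : IsTest ψ) : IsTest (fun x => φ x + ψ x) :=
  ⟨h.1.add h'.1, h.2.add h'.2⟩

lemma mul_left (h : IsTest φ) {f : Space d → ℂ} (hf : ContDiff ℝ ∞ f) :
    IsTest (fun x => f x * φ x) :=
  ⟨hf.mul h.1, h.2.mul_left⟩

lemma conj (h : IsTest φ) : IsTest (fun x => starRingEnd ℂ (φ x)) :=
  ⟨Complex.conjCLE.contDiff.comp h.1, h.2.comp_left (map_zero _)⟩

lemma partialDeriv (h : IsTest φ) (i : Fin d) : IsTest (partialDeriv i φ) :=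
  ⟨(h.1.fderiv_right (m := ∞) (by simp)).clm_apply contDiff_const,
    (h.2.fderiv ℝ).comp_left (g := fun L : Space d →L[ℝ] ℂ => L (EuclideanSpace.single i 1)) rfl⟩

lemma sum {ι : Type*} (s : Finset ι) {f : ι → Space d → ℂ} (hf : ∀ i, IsTest (f i)) :
    IsTest (fun x => ∑ i ∈ s, f i x) := by
  classical
  induction s using Finset.induction_on with
  | empty => simpa using ⟨contDiff_const, HasCompactSupport.zero⟩
  | insert a s ha ih => simpa [Finset.sum_insert ha] using (hf a).add ih

lemma continuous (h : IsTest φ) : Continuous φ := h.1.continuous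

lemma differentiable (h : IsTest φ) : Differentiable ℝ φ := h.1.differentiable (by simp)

lemma memLp (h : IsTest φ) : MemLp φ 2 volume := h.continuous.memLp_of_hasCompactSupport h.2

lemma integrable (h : IsTest φ) : Integrable φ := h.continuous.integrable_of_hasCompactSupport h.2

end IsTest

lemma laplacian_eq_sum_partialDeriv {φ : Space d → ℂ} (h : IsTest φ) (x : Space d) :
    Laplacian.laplacian φ x = ∑ i, partialDeriv i (partialDeriv i φ) x := by
  rw [InnerProductSpace.laplacian_eq_iteratedFDeriv_orthonormalBasis φ
    (EuclideanSpace.basisFun (Fin d) ℝ)]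
  refine Finset.sum_congr rfl fun i _ => ?_
  have hd : DifferentiableAt ℝ (fderiv ℝ φ) x :=
    (h.1.fderiv_right (m := ∞) (by simp)).differentiable (by simp) x
  simp only [iteratedFDeriv_two_apply, EuclideanSpace.basisFun_apply]
  change _ = fderiv ℝ (fun y => fderiv ℝ φ y (EuclideanSpace.single i 1)) x _
  rw [fderiv_clm_apply hd (by fun_prop)]
  simp

lemma partialDeriv_conj {φ : Space d → ℂ} (h : IsTest φ) (i : Fin d) (x : Space d) :
    partialDeriv i (fun x => starRingEnd ℂ (φ x)) x = starRingEnd ℂ (partialDeriv i φ x) := by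
  have := (Complex.conjCLE.toContinuousLinearMap.hasFDerivAt (x := φ x)).comp x
    (h.differentiable x).hasFDerivAt
  simp only [partialDeriv]
  rw [show (fun x => starRingEnd ℂ (φ x)) = Complex.conjCLE.toContinuousLinearMap ∘ φ from rfl,
    this.fderiv]
  rfl

lemma integral_mul_partialDeriv {φ ψ : Space d → ℂ} (hφ : IsTest φ) (hψ : IsTest ψ) (i : Fin d) :
    ∫ x, φ x * partialDeriv i ψ x = -∫ x, partialDeriv i φ x * ψ x :=
  integral_mul_fderiv_eq_neg_fderiv_mul_of_integrable (v := EuclideanSpace.single i (1 : ℝ))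
    (hψ.mul_left (hφ.partialDeriv i).1).integrable ((hψ.partialDeriv i).mul_left hφ.1).integrable
    (hψ.mul_left hφ.1).integrable (fun x _ => hφ.differentiable x) (fun x _ => hψ.differentiable x)

lemma ae_eq_zero_of_integral_test {f : Space d → ℂ} (hf : LocallyIntegrable f volume)
    (h : ∀ φ, IsTest φ → ∫ x, φ x * f x = 0) : f =ᵐ[volume] 0 :=
  ae_eq_zero_of_integral_contDiff_smul_eq_zero hf fun g hg hs => by
    simpa only [Complex.real_smul] using
      h (fun x => (g x : ℂ)) ⟨Complex.ofRealCLM.contDiff.comp hg, 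
        hs.comp_left (g := fun r : ℝ => (r : ℂ)) Complex.ofReal_zero⟩

/-! ### The closed gradient, in the weight `c⁻²` -/

/-- `L²(ℝᵈ; ℂ)`. -/
abbrev L2C (d : ℕ) : Type := Lp ℂ 2 (volume : Measure (Space d))

/-- `L²(ℝᵈ; ℂᵈ)`. -/
abbrev L2V (d : ℕ) : Type := Lp (EuclideanSpace ℂ (Fin d)) 2 (volume : Measure (Space d))

/-- The class of a function in `L²`, and `0` if the function is not square integrable. -/
def toL2 {E : Type*} [NormedAddCommGroup E] (f : Space d → E) :
    Lp E 2 (volume : Measure (Space d)) :=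
  open Classical in if h : MemLp f 2 volume then h.toLp f else 0

lemma toL2_ae {E : Type*} [NormedAddCommGroup E] {f : Space d → E} (h : MemLp f 2 volume) :
    toL2 f =ᵐ[volume] f := by
  rw [toL2, dif_pos h]
  exact h.coeFn_toLp

lemma inner_toL2_left {E : Type*} [NormedAddCommGroup E] [InnerProductSpace ℂ E]
    {f : Space d → E} (hf : MemLp f 2 volume) (v : Lp E 2 (volume : Measure (Space d))) :
    inner ℂ (toL2 f) v = ∫ x, inner ℂ (f x) (v x) := by
  rw [L2.inner_def]
  refine integral_congr_ae ?_
  filter_upwards [toL2_ae hf] with x hx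
  rw [hx]

/-- `∇φ`. -/
def gradVec (φ : Space d → ℂ) : Space d → EuclideanSpace ℂ (Fin d) :=
  fun x => WithLp.toLp 2 fun i => partialDeriv i φ x

lemma IsTest.memLp_gradVec {φ : Space d → ℂ} (h : IsTest φ) : MemLp (gradVec φ) 2 volume := by
  refine Continuous.memLp_of_hasCompactSupport ?_ ?_
  · exact (PiLp.continuous_toLp 2 _).comp (continuous_pi fun i => (h.partialDeriv i).continuous)
  · exact (h.2.fderiv ℝ).comp_left (g := fun L : Space d →L[ℝ] ℂ =>
      (WithLp.toLp 2 fun i => L (EuclideanSpace.single i 1) : EuclideanSpace ℂ (Fin d)))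
      (by ext; simp)

lemma IsTest.memLp_single {φ : Space d → ℂ} (h : IsTest φ) (i : Fin d) :
    MemLp (fun x => EuclideanSpace.single i (φ x)) 2 volume := by
  refine Continuous.memLp_of_hasCompactSupport ?_ ?_
  · exact (PiLp.continuous_toLp 2 _).comp ((continuous_single i).comp h.continuous)
  · exact h.2.comp_left (g := fun z : ℂ => EuclideanSpace.single i z) (by simp)

/-- The graph of the closure of `φ / c ↦ ∇φ`, `φ ∈ C_c^∞`. -/
def gradGraph (c : Space d → ℝ) : Submodule ℂ (WithLp 2 (L2C d × L2V d)) :=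
  (Submodule.span ℂ {v | ∃ φ, IsTest φ ∧
    v = WithLp.toLp 2 (toL2 fun x => (c x : ℂ)⁻¹ * φ x, toL2 (gradVec φ))}).topologicalClosure

instance (c : Space d → ℝ) : (gradGraph c).HasOrthogonalProjection := by
  have : IsClosed (gradGraph c : Set (WithLp 2 (L2C d × L2V d))) :=
    Submodule.isClosed_topologicalClosure _
  have := this.completeSpace_coe
  infer_instance

lemma toL2_mem_gradGraph (c : Space d → ℝ) {φ : Space d → ℂ} (h : IsTest φ) :
    WithLp.toLp 2 (toL2 fun x => (c x : ℂ)⁻¹ * φ x, toL2 (gradVec φ)) ∈ gradGraph c :=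
  Submodule.le_topologicalClosure _ (Submodule.subset_span ⟨φ, h, rfl⟩)

lemma contDiff_ofReal_comp {c : Space d → ℝ} (hc : ContDiff ℝ ∞ c) :
    ContDiff ℝ ∞ fun x => (c x : ℂ) := Complex.ofRealCLM.contDiff.comp hc

lemma contDiff_inv_ofReal_comp {c : Space d → ℝ} (hc : ContDiff ℝ ∞ c) (hpos : ∀ x, 0 < c x) :
    ContDiff ℝ ∞ fun x => (c x : ℂ)⁻¹ :=
  (contDiff_ofReal_comp hc).inv fun x => by exact_mod_cast (hpos x).ne'

/-- The condition is the weak form of `w = c div w'`, so that `-D* w' = c div w'`. Testing on the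
generators of the graph suffices; conjugating `φ` turns inner products into bilinear integrals. -/
lemma mem_gradGraph_orthogonal {c : Space d → ℝ} (hc : ContDiff ℝ ∞ c) (hpos : ∀ x, 0 < c x)
    (w : L2C d) (w' : L2V d)
    (h : ∀ φ, IsTest φ → (∫ x, φ x * ((c x : ℂ)⁻¹ * w x)) + ∫ x, ∑ i, partialDeriv i φ x * w' x i = 0) :
    WithLp.toLp 2 (w, w') ∈ (gradGraph c)ᗮ := by
  rw [gradGraph, Submodule.orthogonal_closure]
  rw [Submodule.mem_orthogonal]
  intro u hu
  induction hu using Submodule.span_induction with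
  | zero => exact inner_zero_left _
  | add x y _ _ hx hy => rw [inner_add_left, hx, hy, add_zero]
  | smul a x _ hx => rw [inner_smul_left, hx, mul_zero]
  | mem u hu =>
    obtain ⟨φ, hφ, rfl⟩ := hu
    have := h _ hφ.conj
    rw [WithLp.prod_inner_apply]
    dsimp only
    rw [inner_toL2_left (hφ.mul_left (contDiff_inv_ofReal_comp hc hpos)).memLp,
      inner_toL2_left hφ.memLp_gradVec, ← this]
    congr 1
    · congr 1 with x
      simp
      ring
    · congr 1 with x
      simp [gradVec, PiLp.inner_apply, partialDeriv_conj hφ, mul_comm]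

lemma integral_of_mem_gradGraph_orthogonal {c : Space d → ℝ} (hc : ContDiff ℝ ∞ c)
    (hpos : ∀ x, 0 < c x) {w : L2C d} {w' : L2V d} (h : WithLp.toLp 2 (w, w') ∈ (gradGraph c)ᗮ)
    {φ : Space d → ℂ} (hφ : IsTest φ) :
    (∫ x, φ x * ((c x : ℂ)⁻¹ * w x)) + ∫ x, ∑ i, partialDeriv i φ x * w' x i = 0 := by
  have := h _ (toL2_mem_gradGraph c hφ.conj)
  rw [WithLp.prod_inner_apply] at this
  dsimp only at this
  rw [inner_toL2_left (hφ.conj.mul_left (contDiff_inv_ofReal_comp hc hpos)).memLp,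
    inner_toL2_left hφ.conj.memLp_gradVec] at this
  rw [← this]
  congr 1
  · congr 1 with x
    simp
    ring
  · congr 1 with x
    simp [gradVec, PiLp.inner_apply, partialDeriv_conj hφ, mul_comm]

lemma div_mem_gradGraph_orthogonal {c : Space d → ℝ} (hc : ContDiff ℝ ∞ c) (hpos : ∀ x, 0 < c x)
    {φ : Space d → ℂ} (hφ : IsTest φ) (i : Fin d) :
    WithLp.toLp 2 (toL2 fun x => (c x : ℂ) * partialDeriv i φ x,
      toL2 fun x => EuclideanSpace.single i (φ x)) ∈ (gradGraph c)ᗮ := by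
  refine mem_gradGraph_orthogonal hc hpos _ _ fun ψ hψ => ?_
  have e1 : ∫ x, ψ x * ((c x : ℂ)⁻¹ * toL2 (fun x => (c x : ℂ) * partialDeriv i φ x) x) =
      ∫ x, ψ x * partialDeriv i φ x := by
    refine integral_congr_ae ?_
    filter_upwards [toL2_ae ((hφ.partialDeriv i).mul_left (contDiff_ofReal_comp hc)).memLp] with x hx
    have : (c x : ℂ) ≠ 0 := by exact_mod_cast (hpos x).ne'
    rw [hx, inv_mul_cancel_left₀ this]
  have e2 : ∫ x, ∑ j, partialDeriv j ψ x * toL2 (fun x => EuclideanSpace.single i (φ x)) x j =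
      ∫ x, partialDeriv i ψ x * φ x := by
    refine integral_congr_ae ?_
    filter_upwards [toL2_ae (hφ.memLp_single i)] with x hx
    rw [hx]
    simp
  rw [e1, e2, integral_mul_partialDeriv hψ hφ, neg_add_cancel]

lemma IsTest.laplacian {φ : Space d → ℂ} (hφ : IsTest φ) : IsTest (Laplacian.laplacian φ) := by
  have : Laplacian.laplacian φ = fun x => ∑ i, _root_.partialDeriv i (_root_.partialDeriv i φ) x :=
    funext (laplacian_eq_sum_partialDeriv hφ)
  rw [this]
  exact IsTest.sum _ fun i => (hφ.partialDeriv i).partialDeriv i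

lemma laplacian_mem_gradGraph_orthogonal {c : Space d → ℝ} (hc : ContDiff ℝ ∞ c)
    (hpos : ∀ x, 0 < c x) {φ : Space d → ℂ} (hφ : IsTest φ) :
    WithLp.toLp 2 (toL2 fun x => (c x : ℂ) * Laplacian.laplacian φ x, toL2 (gradVec φ)) ∈
      (gradGraph c)ᗮ := by
  refine mem_gradGraph_orthogonal hc hpos _ _ fun ψ hψ => ?_
  have e1 : ∫ x, ψ x * ((c x : ℂ)⁻¹ * toL2 (fun x => (c x : ℂ) * Laplacian.laplacian φ x) x) =
      ∫ x, ∑ i, ψ x * partialDeriv i (partialDeriv i φ) x := by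
    refine integral_congr_ae ?_
    filter_upwards [toL2_ae (hφ.laplacian.mul_left (contDiff_ofReal_comp hc)).memLp] with x hx
    have : (c x : ℂ) ≠ 0 := by exact_mod_cast (hpos x).ne'
    rw [hx, inv_mul_cancel_left₀ this, laplacian_eq_sum_partialDeriv hφ, Finset.mul_sum]
  have e2 : ∫ x, ∑ j, partialDeriv j ψ x * toL2 (gradVec φ) x j =
      ∫ x, ∑ j, partialDeriv j ψ x * partialDeriv j φ x := by
    refine integral_congr_ae ?_
    filter_upwards [toL2_ae hφ.memLp_gradVec] with x hx
    rw [hx]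
    rfl
  rw [e1, e2, integral_finsetSum _ fun i _ =>
      (((hφ.partialDeriv i).partialDeriv i).mul_left hψ.1).integrable,
    integral_finsetSum _ fun i _ => ((hφ.partialDeriv i).mul_left (hψ.partialDeriv i).1).integrable,
    ← Finset.sum_add_distrib]
  exact Finset.sum_eq_zero fun i _ => by
    rw [integral_mul_partialDeriv hψ (hφ.partialDeriv i), neg_add_cancel]

lemma MemLp.locallyIntegrable_two {E : Type*} [NormedAddCommGroup E] {f : Space d → E}
    (h : MemLp f 2 volume) : LocallyIntegrable f volume :=
  h.locallyIntegrable (by norm_num)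

lemma memLp_apply {G : Space d → EuclideanSpace ℂ (Fin d)} (hG : MemLp G 2 volume) (i : Fin d) :
    MemLp (fun x => G x i) 2 volume :=
  (EuclideanSpace.proj (𝕜 := ℂ) i : EuclideanSpace ℂ (Fin d) →L[ℂ] ℂ).comp_memLp' hG

/-- Closability of the gradient: `(0, G)` is orthogonal to every `(c ∂ᵢφ, φ eᵢ)`, which tests each
component of `G` to zero. -/
lemma eq_zero_of_mem_gradGraph {c : Space d → ℝ} (hc : ContDiff ℝ ∞ c) (hpos : ∀ x, 0 < c x)
    (G : L2V d) (hG : WithLp.toLp 2 ((0 : L2C d), G) ∈ gradGraph c) : G = 0 := by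
  rw [Lp.eq_zero_iff_ae_eq_zero]
  have h : ∀ i, (fun x => G x i) =ᵐ[volume] 0 := fun i => by
    refine ae_eq_zero_of_integral_test
      (MemLp.locallyIntegrable_two (memLp_apply (Lp.memLp G) i)) fun φ hφ => ?_
    have := div_mem_gradGraph_orthogonal hc hpos hφ.conj i _ hG
    rw [inner_eq_zero_symm, WithLp.prod_inner_apply] at this
    dsimp only at this
    rw [inner_zero_right, zero_add, inner_toL2_left (hφ.conj.memLp_single i)] at this
    rw [← this]
    congr 1 with x
    simp [EuclideanSpace.inner_single_left]
  filter_upwards [ae_all_iff.2 h] with x hx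
  ext i
  exact hx i

/-- Density of the domain: testing with `c φ` cancels the weight. -/
lemma eq_zero_of_mem_gradGraph_orthogonal {c : Space d → ℝ} (hc : ContDiff ℝ ∞ c)
    (hpos : ∀ x, 0 < c x) (h : L2C d) (hh : WithLp.toLp 2 (h, (0 : L2V d)) ∈ (gradGraph c)ᗮ) :
    h = 0 := by
  rw [Lp.eq_zero_iff_ae_eq_zero]
  refine ae_eq_zero_of_integral_test
    (MemLp.locallyIntegrable_two (Lp.memLp h)) fun φ hφ => ?_
  have := integral_of_mem_gradGraph_orthogonal hc hpos hh (hφ.mul_left (contDiff_ofReal_comp hc))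
  have e : ∫ x, ∑ i, partialDeriv i (fun x => (c x : ℂ) * φ x) x * (0 : L2V d) x i = 0 := by
    rw [← integral_zero (Space d) ℂ]
    refine integral_congr_ae ?_
    filter_upwards [Lp.coeFn_zero (EuclideanSpace ℂ (Fin d)) 2 (volume : Measure (Space d))] with x hx
    rw [hx]
    simp
  rw [e, add_zero] at this
  rw [← this]
  congr 1 with x
  have : (c x : ℂ) ≠ 0 := by exact_mod_cast (hpos x).ne'
  field_simp

end

noncomputable section

variable {d : ℕ}

/-! ### Weak gradients and the energy norm -/

lemma IsTest.integrable_mul_locallyIntegrable {φ : Space d → ℂ} (hφ : IsTest φ) {f : Space d → ℂ}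
    (hf : LocallyIntegrable f volume) : Integrable (fun x => f x * φ x) volume := by
  simpa only [smul_eq_mul, mul_comm] using
    hf.integrable_smul_left_of_hasCompactSupport hφ.continuous hφ.2

lemma locallyIntegrable_apply {G : Space d → EuclideanSpace ℂ (Fin d)}
    (hG : LocallyIntegrable G volume) (i : Fin d) : LocallyIntegrable (fun x => G x i) volume :=
  fun x => let ⟨u, hu, h⟩ := hG x
    ⟨u, hu, (EuclideanSpace.proj (𝕜 := ℂ) i : EuclideanSpace ℂ (Fin d) →L[ℂ] ℂ).integrable_comp h⟩

lemma locallyIntegrable_ofReal_mul {c : Space d → ℝ} (hc : ContDiff ℝ ∞ c) {f : Space d → ℂ}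
    (hf : LocallyIntegrable f volume) : LocallyIntegrable (fun x => (c x : ℂ) * f x) volume :=
  hf.continuous_mul (contDiff_ofReal_comp hc).continuous

namespace HasWeakGradient

variable {f f' : Space d → ℂ} {G G' : Space d → EuclideanSpace ℂ (Fin d)}

lemma ae_eq (h : HasWeakGradient f G) (h' : HasWeakGradient f G') : G =ᵐ[volume] G' := by
  have key : ∀ i, (fun x => G x i - G' x i) =ᵐ[volume] 0 := fun i => by
    have hG := locallyIntegrable_apply h.2.1 i
    have hG' := locallyIntegrable_apply h'.2.1 i
    refine ae_eq_zero_of_integral_test (hG.sub hG') fun φ hφ => ?_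
    have e := h.2.2 φ hφ.1 hφ.2 i
    rw [h'.2.2 φ hφ.1 hφ.2 i, neg_inj] at e
    simp only [mul_comm (φ _), sub_mul]
    rw [integral_sub (hφ.integrable_mul_locallyIntegrable hG)
      (hφ.integrable_mul_locallyIntegrable hG'), e, sub_self]
  filter_upwards [ae_all_iff.2 key] with x hx
  ext i
  exact sub_eq_zero.1 (hx i)

lemma congr (h : HasWeakGradient f G) (hG : G =ᵐ[volume] G') : HasWeakGradient f G' := by
  refine ⟨h.1, h.2.1.congr hG, fun φ h1 h2 i => (h.2.2 φ h1 h2 i).trans ?_⟩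
  congr 1
  refine integral_congr_ae ?_
  filter_upwards [hG] with x hx
  rw [hx]

lemma add_smul (h : HasWeakGradient f G) (a : ℂ) (h' : HasWeakGradient f' G') :
    HasWeakGradient (f + a • f') (G + a • G') := by
  refine ⟨h.1.add (h'.1.smul a), h.2.1.add (h'.2.1.smul a), fun φ h1 h2 i => ?_⟩
  have hφ : IsTest φ := ⟨h1, h2⟩
  have hi := hφ.partialDeriv i
  simp only [Pi.add_apply, Pi.smul_apply, PiLp.add_apply, PiLp.smul_apply, smul_eq_mul, add_mul,
    mul_assoc]
  rw [integral_add (hi.integrable_mul_locallyIntegrable h.1)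
      ((hi.integrable_mul_locallyIntegrable h'.1).const_mul a),
    integral_add (hφ.integrable_mul_locallyIntegrable (locallyIntegrable_apply h.2.1 i))
      ((hφ.integrable_mul_locallyIntegrable (locallyIntegrable_apply h'.2.1 i)).const_mul a),
    integral_const_mul, integral_const_mul, h.2.2 φ h1 h2 i, h'.2.2 φ h1 h2 i]
  ring

end HasWeakGradient

/-- Weak gradients are unique almost everywhere, so the infimum runs over equal values. -/
lemma energyNorm_eq {c : Space d → ℝ} {f g : Space d → ℂ} {G : Space d → EuclideanSpace ℂ (Fin d)}
    (hG : HasWeakGradient f G) (hg : AEStronglyMeasurable g volume) :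
    energyNorm c f g =
      (2⁻¹ * ∫⁻ x, (ENNReal.ofReal ((c x ^ 2)⁻¹) * ‖g x‖ₑ ^ 2 + ‖G x‖ₑ ^ 2)) ^ (1 / 2 : ℝ) := by
  refine le_antisymm (iInf_le_of_le G (iInf_le_of_le hG (iInf_le _ hg))) ?_
  refine le_iInf fun G' => le_iInf fun hG' => le_iInf fun _ => le_of_eq ?_
  congr 2
  refine lintegral_congr_ae ?_
  filter_upwards [hG.ae_eq hG'] with x hx
  rw [hx]

/-- The state `(f, g)` has finite energy and is represented by `v = (g / c, ∇f)`. -/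
structure IsState (c : Space d → ℝ) (f g : Space d → ℂ) (v : WithLp 2 (L2C d × L2V d)) : Prop where
  weakGradient : HasWeakGradient f v.snd
  fst_ae : v.fst =ᵐ[volume] fun x => (c x : ℂ)⁻¹ * g x

lemma lintegral_enorm_sq_eq {E : Type*} [NormedAddCommGroup E]
    (f : Lp E 2 (volume : Measure (Space d))) : ∫⁻ x, ‖f x‖ₑ ^ 2 = ‖f‖ₑ ^ 2 := by
  rw [Lp.enorm_def, eLpNorm_eq_lintegral_rpow_enorm_toReal (by norm_num) (by norm_num),
    ← ENNReal.rpow_natCast, ← ENNReal.rpow_mul]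
  simp

lemma enorm_sq_eq_of_L2 {E F : Type*} [NormedAddCommGroup E] [NormedAddCommGroup F]
    (v : WithLp 2 (E × F)) : ‖v‖ₑ ^ 2 = ‖v.fst‖ₑ ^ 2 + ‖v.snd‖ₑ ^ 2 := by
  simp only [← ofReal_norm, ← ENNReal.ofReal_pow (norm_nonneg _)]
  rw [WithLp.prod_norm_sq_eq_of_L2, ENNReal.ofReal_add (by positivity) (by positivity)]

lemma ofReal_inv_sq_mul_enorm_sq {a : ℝ} (ha : 0 < a) (z : ℂ) :
    ENNReal.ofReal ((a ^ 2)⁻¹) * ‖z‖ₑ ^ 2 = ‖(a : ℂ)⁻¹ * z‖ₑ ^ 2 := by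
  simp only [← ofReal_norm, ← ENNReal.ofReal_pow (norm_nonneg _)]
  rw [← ENNReal.ofReal_mul (by positivity), norm_mul, norm_inv, Complex.norm_real,
    Real.norm_of_nonneg ha.le, mul_pow, inv_pow]

namespace IsState

variable {c : Space d → ℝ} {f g f' g' : Space d → ℂ} {v v' : WithLp 2 (L2C d × L2V d)}

lemma ae_eq_mul (hpos : ∀ x, 0 < c x) (h : IsState c f g v) :
    g =ᵐ[volume] fun x => (c x : ℂ) * v.fst x := by
  filter_upwards [h.fst_ae] with x hx
  have : (c x : ℂ) ≠ 0 := by exact_mod_cast (hpos x).ne'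
  rw [hx, mul_inv_cancel_left₀ this]

lemma aestronglyMeasurable (hc : ContDiff ℝ ∞ c) (hpos : ∀ x, 0 < c x) (h : IsState c f g v) :
    AEStronglyMeasurable g volume :=
  ((contDiff_ofReal_comp hc).continuous.aestronglyMeasurable.mul
    (Lp.aestronglyMeasurable _)).congr (h.ae_eq_mul hpos).symm

lemma energyNorm_eq (hc : ContDiff ℝ ∞ c) (hpos : ∀ x, 0 < c x) (h : IsState c f g v) :
    energyNorm c f g = (2⁻¹ : ℝ≥0∞) ^ (1 / 2 : ℝ) * ‖v‖ₑ := by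
  rw [_root_.energyNorm_eq h.weakGradient (h.aestronglyMeasurable hc hpos)]
  have e : ∫⁻ x, (ENNReal.ofReal ((c x ^ 2)⁻¹) * ‖g x‖ₑ ^ 2 + ‖v.snd x‖ₑ ^ 2) = ‖v‖ₑ ^ 2 := by
    rw [enorm_sq_eq_of_L2, ← lintegral_enorm_sq_eq v.fst, ← lintegral_enorm_sq_eq v.snd,
      ← lintegral_add_left' ((Lp.aestronglyMeasurable v.fst).enorm.pow_const 2)]
    refine lintegral_congr_ae ?_
    filter_upwards [h.fst_ae] with x hx
    rw [ofReal_inv_sq_mul_enorm_sq (hpos x), hx]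
  rw [e, ENNReal.mul_rpow_of_nonneg _ _ (by norm_num), ← ENNReal.rpow_natCast, ← ENNReal.rpow_mul]
  norm_num

lemma add_smul (h : IsState c f g v) (a : ℂ) (h' : IsState c f' g' v') :
    IsState c (f + a • f') (g + a • g') (v + a • v') := by
  refine ⟨(h.1.add_smul a h'.1).congr ?_, ?_⟩
  · filter_upwards [Lp.coeFn_add v.snd (a • v'.snd), Lp.coeFn_smul a v'.snd] with x h1 h2
    simp only [WithLp.add_snd, WithLp.smul_snd, h1, Pi.add_apply, h2, Pi.smul_apply]
  · filter_upwards [Lp.coeFn_add v.fst (a • v'.fst), Lp.coeFn_smul a v'.fst, h.2, h'.2]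
      with x h1 h2 h3 h4
    simp only [WithLp.add_fst, WithLp.smul_fst, h1, Pi.add_apply, h2, Pi.smul_apply, h3, h4,
      smul_eq_mul]
    ring

lemma add (h : IsState c f g v) (h' : IsState c f' g' v') :
    IsState c (f + f') (g + g') (v + v') := by
  simpa using h.add_smul 1 h'

lemma sub (h : IsState c f g v) (h' : IsState c f' g' v') :
    IsState c (f - f') (g - g') (v - v') := by
  simpa [sub_eq_add_neg] using h.add_smul (-1) h'

lemma energyNorm_ne_top (hc : ContDiff ℝ ∞ c) (hpos : ∀ x, 0 < c x) (h : IsState c f g v) :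
    energyNorm c f g ≠ ⊤ := by
  rw [h.energyNorm_eq hc hpos]
  exact ENNReal.mul_ne_top (ENNReal.rpow_ne_top_of_nonneg (by norm_num) (by norm_num))
    enorm_ne_top

end IsState

lemma exists_isState {c : Space d → ℝ} (hc : ContDiff ℝ ∞ c) (hpos : ∀ x, 0 < c x)
    {f g : Space d → ℂ} (h : energyNorm c f g ≠ ⊤) : ∃ v, IsState c f g v := by
  obtain ⟨G, hG, hg, hlt⟩ : ∃ G, ∃ _ : HasWeakGradient f G, ∃ _ : AEStronglyMeasurable g volume,
      (2⁻¹ * ∫⁻ x, (ENNReal.ofReal ((c x ^ 2)⁻¹) * ‖g x‖ₑ ^ 2 + ‖G x‖ₑ ^ 2)) ^ (1 / 2 : ℝ) < ⊤ := by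
    simpa only [energyNorm, ← lt_top_iff_ne_top, iInf_lt_iff] using h
  have hfin : ∫⁻ x, (ENNReal.ofReal ((c x ^ 2)⁻¹) * ‖g x‖ₑ ^ 2 + ‖G x‖ₑ ^ 2) < ⊤ := by
    rw [ENNReal.rpow_lt_top_iff_of_pos (by norm_num), ENNReal.mul_lt_top_iff] at hlt
    rcases hlt with h | h | h
    · exact h.2
    · simp at h
    · simp [h]
  have hgm : AEStronglyMeasurable (fun x => (c x : ℂ)⁻¹ * g x) volume :=
    (contDiff_inv_ofReal_comp hc hpos).continuous.aestronglyMeasurable.mul hg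
  have mem : ∀ {E : Type} [NormedAddCommGroup E] {F : Space d → E},
      AEStronglyMeasurable F volume → ∫⁻ x, ‖F x‖ₑ ^ 2 < ⊤ → MemLp F 2 volume := by
    intro E _ F hF h
    refine ⟨hF, (eLpNorm_lt_top_iff_lintegral_rpow_enorm_lt_top (by norm_num) (by norm_num)).2 ?_⟩
    simpa using h
  have m1 : MemLp (fun x => (c x : ℂ)⁻¹ * g x) 2 volume :=
    mem hgm (lt_of_le_of_lt (lintegral_mono fun x => by
      rw [← ofReal_inv_sq_mul_enorm_sq (hpos x)]; exact le_self_add) hfin)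
  have m2 : MemLp G 2 volume :=
    mem hG.2.1.aestronglyMeasurable (lt_of_le_of_lt (lintegral_mono fun x => le_add_self) hfin)
  exact ⟨WithLp.toLp 2 (toL2 fun x => (c x : ℂ)⁻¹ * g x, toL2 G), hG.congr (toL2_ae m2).symm,
    toL2_ae m1⟩

end

noncomputable section

variable {d : ℕ}

/-! ### Solutions of the wave equation -/

/-- The unitary group of the wave equation on states `(∂ₜu / c, ∇u)`, with Dirichlet conditions
at infinity. -/
def waveGroup (c : Space d → ℝ) (t : ℝ) : WithLp 2 (L2C d × L2V d) →L[ℂ] WithLp 2 (L2C d × L2V d) :=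
  cayleyGroup (graphCayley (gradGraph c)) t

section

variable {c : Space d → ℝ}

lemma graphCayley_gradGraph_ker (hc : ContDiff ℝ ∞ c) (hpos : ∀ x, 0 < c x)
    (x : WithLp 2 (L2C d × L2V d)) (hx : graphCayley (gradGraph c) x = -x) : x = 0 :=
  eq_zero_of_graphCayley_eq_neg (eq_zero_of_mem_gradGraph hc hpos)
    (eq_zero_of_mem_gradGraph_orthogonal hc hpos) x hx

lemma norm_waveGroup_apply (hc : ContDiff ℝ ∞ c) (hpos : ∀ x, 0 < c x) (t : ℝ)
    (v : WithLp 2 (L2C d × L2V d)) : ‖waveGroup c t v‖ = ‖v‖ :=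
  norm_cayleyGroup_apply (graphCayley_mem_unitary _) (graphCayley_gradGraph_ker hc hpos) t v

lemma continuous_waveGroup (hc : ContDiff ℝ ∞ c) (hpos : ∀ x, 0 < c x)
    (v : WithLp 2 (L2C d × L2V d)) : Continuous fun t => waveGroup c t v :=
  continuous_cayleyGroup (graphCayley_mem_unitary _) (graphCayley_gradGraph_ker hc hpos) v

lemma waveGroup_zero (hc : ContDiff ℝ ∞ c) (hpos : ∀ x, 0 < c x)
    (v : WithLp 2 (L2C d × L2V d)) : waveGroup c 0 v = v :=
  cayleyGroup_zero (graphCayley_mem_unitary _) (graphCayley_gradGraph_ker hc hpos) v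

/-- The weak wave equation. The chain under `A` is `(φ / c, 0) ↦ (0, ∇φ) ↦ (c Δφ, 0)`. -/
lemma hasDerivAt_inner_fst_waveGroup (hc : ContDiff ℝ ∞ c) (hpos : ∀ x, 0 < c x) {φ : Space d → ℂ}
    (hφ : IsTest φ) (v : WithLp 2 (L2C d × L2V d)) (t : ℝ) :
    HasDerivAt (fun t => inner ℂ (toL2 fun x => (c x : ℂ)⁻¹ * φ x) (waveGroup c t v).fst)
      (-inner ℂ (toL2 (gradVec φ)) (waveGroup c t v).snd) t := by
  have h1 := graphCayley_sub (toL2_mem_gradGraph c hφ) (gradGraph c)ᗮ.zero_mem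
  have h2 := graphCayley_sub (gradGraph c).zero_mem (laplacian_mem_gradGraph_orthogonal hc hpos hφ)
  simpa [WithLp.prod_inner_apply, waveGroup] using hasDerivAt_inner_cayleyGroup (graphCayley_mem_unitary _)
    (graphCayley_gradGraph_ker hc hpos) h1 h2 v t

/-- The weak form of `∂ₜ∇u = ∇∂ₜu`. The chain under `A` is `(0, φ eᵢ) ↦ (c ∂ᵢφ, 0) ↦ (0, ∇(c²
∂ᵢφ))`. -/
lemma hasDerivAt_inner_snd_waveGroup (hc : ContDiff ℝ ∞ c) (hpos : ∀ x, 0 < c x) {φ : Space d → ℂ}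
    (hφ : IsTest φ) (i : Fin d) (v : WithLp 2 (L2C d × L2V d)) (t : ℝ) :
    HasDerivAt (fun t => inner ℂ (toL2 fun x => EuclideanSpace.single i (φ x)) (waveGroup c t v).snd)
      (-inner ℂ (toL2 fun x => (c x : ℂ) * partialDeriv i φ x) (waveGroup c t v).fst) t := by
  have h1 := graphCayley_sub (gradGraph c).zero_mem (div_mem_gradGraph_orthogonal hc hpos hφ i)
  have hψ := (((hφ.partialDeriv i).mul_left (contDiff_ofReal_comp hc)).mul_left
    (contDiff_ofReal_comp hc))
  have e : (fun x => (c x : ℂ)⁻¹ * ((c x : ℂ) * ((c x : ℂ) * partialDeriv i φ x))) =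
      fun x => (c x : ℂ) * partialDeriv i φ x := by
    ext x
    have : (c x : ℂ) ≠ 0 := by exact_mod_cast (hpos x).ne'
    rw [inv_mul_cancel_left₀ this]
  have h2 := toL2_mem_gradGraph c hψ
  rw [e] at h2
  have h2 := graphCayley_sub h2 (gradGraph c)ᗮ.zero_mem
  simpa [WithLp.prod_inner_apply, waveGroup] using hasDerivAt_inner_cayleyGroup (graphCayley_mem_unitary _)
    (graphCayley_gradGraph_ker hc hpos) h1 h2 v t

/-- `∫₀ᵗ ∂ₜu / c`. -/
def waveIncrement (c : Space d → ℝ) (v : WithLp 2 (L2C d × L2V d)) (t : ℝ) : L2C d :=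
  ∫ τ in (0 : ℝ)..t, (waveGroup c τ v).fst

lemma continuous_fst_waveGroup (hc : ContDiff ℝ ∞ c) (hpos : ∀ x, 0 < c x)
    (v : WithLp 2 (L2C d × L2V d)) : Continuous fun t => (waveGroup c t v).fst :=
  (WithLp.prod_continuous_ofLp 2 _ _).fst.comp (continuous_waveGroup hc hpos v)

lemma hasDerivAt_waveIncrement (hc : ContDiff ℝ ∞ c) (hpos : ∀ x, 0 < c x)
    (v : WithLp 2 (L2C d × L2V d)) (t : ℝ) :
    HasDerivAt (waveIncrement c v) (waveGroup c t v).fst t :=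
  ((continuous_fst_waveGroup hc hpos v).integral_hasStrictDerivAt 0 t).hasDerivAt

lemma inner_single_eq_integral {φ : Space d → ℂ} (hφ : IsTest φ) (i : Fin d) (w : L2V d) :
    inner ℂ (toL2 fun x => EuclideanSpace.single i (starRingEnd ℂ (φ x))) w = ∫ x, w x i * φ x := by
  rw [inner_toL2_left (hφ.conj.memLp_single i)]
  congr 1 with x
  simp [EuclideanSpace.inner_single_left, mul_comm]

lemma inner_conj_eq_integral {φ : Space d → ℂ} (hφ : IsTest φ) (w : L2C d) :
    inner ℂ (toL2 fun x => starRingEnd ℂ (φ x)) w = ∫ x, w x * φ x := by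
  rw [inner_toL2_left hφ.conj.memLp]
  congr 1 with x
  simp

/-- Integrating `∂ₜ∇u = ∇∂ₜu` in time shows that the second component of the state remains the
gradient of a displacement. The displacement itself need not be in `L²`, so it is rebuilt from its
initial value and its velocity. -/
lemma integral_waveIncrement_mul_partialDeriv (hc : ContDiff ℝ ∞ c) (hpos : ∀ x, 0 < c x)
    {φ : Space d → ℂ} (hφ : IsTest φ) (i : Fin d) (v : WithLp 2 (L2C d × L2V d)) (t : ℝ) :
    ∫ x, (c x : ℂ) * waveIncrement c v t x * partialDeriv i φ x =
      (∫ x, v.snd x i * φ x) - ∫ x, (waveGroup c t v).snd x i * φ x := by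
  set a : L2C d := toL2 fun x => (c x : ℂ) * partialDeriv i (fun x => starRingEnd ℂ (φ x)) x with ha
  have hcont : Continuous fun t => inner ℂ a (waveGroup c t v).fst :=
    continuous_const.inner (continuous_fst_waveGroup hc hpos v)
  have h := intervalIntegral.integral_eq_sub_of_hasDerivAt
    (fun τ _ => hasDerivAt_inner_snd_waveGroup hc hpos hφ.conj i v τ)
    (hcont.neg.intervalIntegrable 0 t)
  rw [inner_single_eq_integral hφ, inner_single_eq_integral hφ, waveGroup_zero hc hpos,
    intervalIntegral.integral_neg] at h
  have h' : ∫ τ in (0 : ℝ)..t, inner ℂ a (waveGroup c τ v).fst = inner ℂ a (waveIncrement c v t) :=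
    ContinuousLinearMap.intervalIntegral_comp_comm ((innerSL ℂ a).restrictScalars ℝ)
      ((continuous_fst_waveGroup hc hpos v).intervalIntegrable 0 t)
  have e : a = toL2 fun x => starRingEnd ℂ ((c x : ℂ) * partialDeriv i φ x) := by
    rw [ha]
    congr 1 with x
    rw [partialDeriv_conj hφ, map_mul, Complex.conj_ofReal]
  rw [h', e, inner_conj_eq_integral ((hφ.partialDeriv i).mul_left (contDiff_ofReal_comp hc))] at h
  rw [← neg_sub, ← h, neg_neg]
  congr 1 with x
  ring

/-- The displacement of the solution with initial displacement `f` and initial state `v`. -/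
def waveFlow (c : Space d → ℝ) (f : Space d → ℂ) (v : WithLp 2 (L2C d × L2V d)) :
    ℝ → Space d → ℂ := fun t x => f x + (c x : ℂ) * waveIncrement c v t x

/-- The velocity of the solution with initial state `v`. -/
def waveFlowVelocity (c : Space d → ℝ) (v : WithLp 2 (L2C d × L2V d)) : ℝ → Space d → ℂ :=
  fun t x => (c x : ℂ) * (waveGroup c t v).fst x

variable {f g : Space d → ℂ} {v : WithLp 2 (L2C d × L2V d)}

lemma isState_waveFlow (hc : ContDiff ℝ ∞ c) (hpos : ∀ x, 0 < c x) (h : IsState c f g v) (t : ℝ) :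
    IsState c (waveFlow c f v t) (waveFlowVelocity c v t) (waveGroup c t v) := by
  have hI : LocallyIntegrable (fun x => (c x : ℂ) * waveIncrement c v t x) volume :=
    locallyIntegrable_ofReal_mul hc (MemLp.locallyIntegrable_two (Lp.memLp _))
  refine ⟨⟨h.1.1.add hI, MemLp.locallyIntegrable_two (Lp.memLp _), fun φ h1 h2 i => ?_⟩, ?_⟩
  · have hφ : IsTest φ := ⟨h1, h2⟩
    simp only [waveFlow, add_mul]
    rw [integral_add ((hφ.partialDeriv i).integrable_mul_locallyIntegrable h.1.1)
      ((hφ.partialDeriv i).integrable_mul_locallyIntegrable hI), h.1.2.2 φ h1 h2 i,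
      integral_waveIncrement_mul_partialDeriv hc hpos hφ]
    ring
  · refine Eventually.of_forall fun x => ?_
    have : (c x : ℂ) ≠ 0 := by exact_mod_cast (hpos x).ne'
    simp only [waveFlowVelocity]
    rw [inv_mul_cancel_left₀ this]

lemma integral_mul_laplacian {f : Space d → ℂ} {G : Space d → EuclideanSpace ℂ (Fin d)}
    (h : HasWeakGradient f G) {φ : Space d → ℂ} (hφ : IsTest φ) :
    ∫ x, f x * Laplacian.laplacian φ x = -∫ x, ∑ i, G x i * partialDeriv i φ x := by
  simp only [laplacian_eq_sum_partialDeriv hφ, Finset.mul_sum]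
  rw [integral_finsetSum _ fun i _ =>
      ((hφ.partialDeriv i).partialDeriv i).integrable_mul_locallyIntegrable h.1,
    integral_finsetSum _ fun i _ =>
      (hφ.partialDeriv i).integrable_mul_locallyIntegrable (locallyIntegrable_apply h.2.1 i),
    ← Finset.sum_neg_distrib]
  exact Finset.sum_congr rfl fun i _ =>
    h.2.2 _ (hφ.partialDeriv i).1 (hφ.partialDeriv i).2 i

lemma isWaveSolution_waveFlow (hc : ContDiff ℝ ∞ c) (hpos : ∀ x, 0 < c x) (h : IsState c f g v) :
    IsWaveSolution c (waveFlow c f v) (waveFlowVelocity c v) := by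
  have hs := isState_waveFlow hc hpos h
  refine ⟨fun t => (hs t).energyNorm_ne_top hc hpos, fun t => ?_, fun t => ?_, fun φ h1 h2 t => ?_⟩
  · have h0 : Tendsto (fun s => (2⁻¹ : ℝ≥0∞) ^ (1 / 2 : ℝ) * ‖waveGroup c s v - waveGroup c t v‖ₑ)
        (𝓝 t) (𝓝 0) := by
      have h1 : Tendsto (fun s => ‖waveGroup c s v - waveGroup c t v‖ₑ) (𝓝 t) (𝓝 0) := by
        have : Continuous fun s => ‖waveGroup c s v - waveGroup c t v‖ₑ :=
          ((continuous_waveGroup hc hpos v).sub continuous_const).enorm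
        simpa using this.tendsto t
      simpa using ENNReal.Tendsto.const_mul h1
        (Or.inr (ENNReal.rpow_ne_top_of_nonneg (by norm_num : (0 : ℝ) ≤ 1 / 2) (by norm_num)))
    refine h0.congr fun s => ?_
    rw [((hs s).sub (hs t)).energyNorm_eq hc hpos]
  · have h0 := (hasDerivAt_iff_tendsto_slope_zero.1 (hasDerivAt_waveIncrement hc hpos v t))
    have h1 := ((ENNReal.continuous_pow 2).tendsto _).comp
      (h0.sub_const (waveGroup c t v).fst).enorm
    simp only [sub_self, enorm_zero, ne_eq, OfNat.ofNat_ne_zero, not_false_eq_true, zero_pow] at h1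
    refine h1.congr fun r => ?_
    rw [Function.comp_apply, ← lintegral_enorm_sq_eq]
    refine lintegral_congr_ae ?_
    filter_upwards [Lp.coeFn_sub (r⁻¹ • (waveIncrement c v (t + r) - waveIncrement c v t))
      (waveGroup c t v).fst, Lp.coeFn_smul r⁻¹ (waveIncrement c v (t + r) - waveIncrement c v t),
      Lp.coeFn_sub (waveIncrement c v (t + r)) (waveIncrement c v t)] with x e1 e2 e3
    have : (c x : ℂ) ≠ 0 := by exact_mod_cast (hpos x).ne'
    rw [e1, Pi.sub_apply, e2, Pi.smul_apply, e3, Pi.sub_apply, ofReal_inv_sq_mul_enorm_sq (hpos x)]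
    congr 2
    simp only [waveFlow, waveFlowVelocity, Complex.real_smul, Complex.ofReal_inv]
    field_simp
    ring
  · have hφ : IsTest φ := ⟨h1, h2⟩
    have hd := hasDerivAt_inner_fst_waveGroup hc hpos hφ.conj v t
    refine (hd.congr_deriv ?_).congr_of_eventuallyEq (Eventually.of_forall fun s => ?_)
    · rw [integral_mul_laplacian (hs t).1 hφ, inner_toL2_left hφ.conj.memLp_gradVec]
      congr 2 with x
      simp [gradVec, PiLp.inner_apply, partialDeriv_conj hφ]
    · dsimp only
      rw [inner_toL2_left (hφ.conj.mul_left (contDiff_inv_ofReal_comp hc hpos)).memLp]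
      congr 1 with x
      have : (c x : ℂ) ≠ 0 := by exact_mod_cast (hpos x).ne'
      simp [waveFlowVelocity]
      field_simp

lemma IsWaveSolution.comp_sub {u ut : ℝ → Space d → ℂ} (h : IsWaveSolution c u ut) (s : ℝ) :
    IsWaveSolution c (fun t => u (t - s)) (fun t => ut (t - s)) := by
  have hs : ∀ t, Tendsto (fun r => r - s) (𝓝 t) (𝓝 (t - s)) := fun t =>
    (continuous_sub_right s).tendsto t
  refine ⟨fun t => h.1 _, fun t => (h.2 (t - s)).comp (hs t), fun t => ?_, fun φ h1 h2 t => ?_⟩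
  · simpa only [add_sub_right_comm] using h.3 (t - s)
  · exact (h.4 φ h1 h2 (t - s)).comp_sub_const t s

/-- Finite energy Cauchy data at time `s` have a solution that preserves the energy. -/
lemma exists_isWaveSolution (hc : ContDiff ℝ ∞ c) (hpos : ∀ x, 0 < c x)
    (h : energyNorm c f g ≠ ⊤) (s : ℝ) :
    ∃ z zt : ℝ → Space d → ℂ, IsWaveSolution c z zt ∧ z s =ᵐ[volume] f ∧ zt s =ᵐ[volume] g ∧
      ∀ t, energyNorm c (z t) (zt t) = energyNorm c f g := by
  obtain ⟨v, hv⟩ := exists_isState hc hpos h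
  refine ⟨_, _, (isWaveSolution_waveFlow hc hpos hv).comp_sub s, ?_, ?_, fun t => ?_⟩
  · have : waveIncrement c v 0 = 0 := intervalIntegral.integral_same
    filter_upwards [Lp.coeFn_zero ℂ 2 (volume : Measure (Space d))] with x hx
    rw [sub_self, waveFlow, this, hx]
    simp
  · filter_upwards [hv.ae_eq_mul hpos] with x hx
    simp [waveFlowVelocity, waveGroup_zero hc hpos, hx]
  · rw [(isState_waveFlow hc hpos hv (t - s)).energyNorm_eq hc hpos, hv.energyNorm_eq hc hpos,
      ← ofReal_norm, norm_waveGroup_apply hc hpos, ofReal_norm]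

/-! ### Seminorm properties of the energy norm and superposition of wave solutions. -/

lemma energyNorm_add_le (hc : ContDiff ℝ ∞ c) (hpos : ∀ x, 0 < c x) (f g f' g' : Space d → ℂ) :
    energyNorm c (f + f') (g + g') ≤ energyNorm c f g + energyNorm c f' g' := by
  by_cases h : energyNorm c f g = ⊤
  · simp [h]
  by_cases h' : energyNorm c f' g' = ⊤
  · simp [h']
  obtain ⟨v, hv⟩ := exists_isState hc hpos h
  obtain ⟨v', hv'⟩ := exists_isState hc hpos h'
  rw [(hv.add hv').energyNorm_eq hc hpos, hv.energyNorm_eq hc hpos, hv'.energyNorm_eq hc hpos,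
    ← mul_add]
  gcongr
  exact enorm_add_le _ _

lemma energyNorm_neg (f g : Space d → ℂ) : energyNorm c (-f) (-g) = energyNorm c f g := by
  have key : ∀ f g : Space d → ℂ, energyNorm c f g ≤ energyNorm c (-f) (-g) := fun f g => by
    refine le_iInf fun G => le_iInf fun hG => le_iInf fun hg => ?_
    have hG' : HasWeakGradient f (-G) := by
      have h0 : HasWeakGradient (0 : Space d → ℂ) (0 : Space d → EuclideanSpace ℂ (Fin d)) :=
        ⟨locallyIntegrable_zero, locallyIntegrable_zero, by simp⟩
      simpa using h0.add_smul (-1) hG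
    refine (energyNorm_eq hG' (by simpa using hg.neg)).trans_le ?_
    simp
  exact le_antisymm (by simpa using key (-f) (-g)) (key f g)

lemma energyNorm_eq_zero (hc : ContDiff ℝ ∞ c) (hpos : ∀ x, 0 < c x) (hf : f =ᵐ[volume] 0)
    (hg : g =ᵐ[volume] 0) : energyNorm c f g = 0 := by
  have hz : IsState c f g 0 := by
    refine ⟨⟨locallyIntegrable_zero.congr hf.symm,
      MemLp.locallyIntegrable_two (Lp.memLp _), fun φ _ _ i => ?_⟩, ?_⟩
    · have e1 : ∫ x, f x * partialDeriv i φ x = 0 := by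
        rw [← integral_zero (Space d) ℂ]
        refine integral_congr_ae ?_
        filter_upwards [hf] with x hx
        simp [hx]
      have e2 : ∫ x, (0 : WithLp 2 (L2C d × L2V d)).snd x i * φ x = 0 := by
        rw [← integral_zero (Space d) ℂ]
        refine integral_congr_ae ?_
        filter_upwards [Lp.coeFn_zero (EuclideanSpace ℂ (Fin d)) 2
          (volume : Measure (Space d))] with x hx
        rw [WithLp.zero_snd, hx]
        simp
      rw [e1, e2, neg_zero]
    · filter_upwards [Lp.coeFn_zero ℂ 2 (volume : Measure (Space d)), hg] with x hx hx'
      rw [WithLp.zero_fst, hx, hx']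
      simp
  rw [hz.energyNorm_eq hc hpos, enorm_zero, mul_zero]

lemma lintegral_mul_enorm_add_sq_le (w : Space d → ℝ≥0∞) {a b : Space d → ℂ} (hw : AEMeasurable w)
    (ha : AEStronglyMeasurable a volume) :
    ∫⁻ x, w x * ‖a x + b x‖ₑ ^ 2 ≤ 2 * ((∫⁻ x, w x * ‖a x‖ₑ ^ 2) + ∫⁻ x, w x * ‖b x‖ₑ ^ 2) := by
  rw [← lintegral_add_left' (f := fun x => w x * ‖a x‖ₑ ^ 2) (hw.mul (ha.enorm.pow_const 2)), ← lintegral_const_mul' _ _ (by simp)]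
  refine lintegral_mono fun x => ?_
  have h1 : ‖a x + b x‖ₑ ^ 2 ≤ 2 * (‖a x‖ₑ ^ 2 + ‖b x‖ₑ ^ 2) := by
    have h2 := ENNReal.rpow_add_le_mul_rpow_add_rpow ‖a x‖ₑ ‖b x‖ₑ (one_le_two (α := ℝ))
    norm_num at h2
    exact (pow_le_pow_left' (enorm_add_le _ _) 2).trans h2
  calc w x * ‖a x + b x‖ₑ ^ 2 ≤ w x * (2 * (‖a x‖ₑ ^ 2 + ‖b x‖ₑ ^ 2)) := by gcongr
    _ = _ := by ring

lemma IsWaveSolution.add (hc : ContDiff ℝ ∞ c) (hpos : ∀ x, 0 < c x) {u ut z zt : ℝ → Space d → ℂ}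
    (h : IsWaveSolution c u ut) (h' : IsWaveSolution c z zt) :
    IsWaveSolution c (u + z) (ut + zt) := by
  have hm : ∀ {u ut : ℝ → Space d → ℂ}, IsWaveSolution c u ut → ∀ t,
      AEStronglyMeasurable (u t) volume ∧ LocallyIntegrable (u t) volume ∧
        LocallyIntegrable (ut t) volume := by
    intro u ut h t
    obtain ⟨v, hv⟩ := exists_isState hc hpos (h.1 t)
    exact ⟨hv.1.1.aestronglyMeasurable, hv.1.1, (locallyIntegrable_ofReal_mul hc
      (MemLp.locallyIntegrable_two (Lp.memLp v.fst))).congr (hv.ae_eq_mul hpos).symm⟩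
  refine ⟨fun t => ?_, fun t => ?_, fun t => ?_, fun φ h1 h2 t => ?_⟩
  · exact ((energyNorm_add_le hc hpos _ _ _ _).trans_lt
      (ENNReal.add_lt_top.2 ⟨(h.1 t).lt_top, (h'.1 t).lt_top⟩)).ne
  · refine tendsto_of_tendsto_of_tendsto_of_le_of_le tendsto_const_nhds
      (by simpa using (h.2 t).add (h'.2 t)) (fun _ => zero_le) fun s => ?_
    simp only [Pi.add_apply, add_sub_add_comm]
    exact energyNorm_add_le hc hpos _ _ _ _
  · have h0 := ENNReal.Tendsto.const_mul ((h.3 t).add (h'.3 t))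
      (Or.inr (ENNReal.ofNat_ne_top (n := 2)))
    rw [add_zero, mul_zero] at h0
    refine tendsto_of_tendsto_of_tendsto_of_le_of_le tendsto_const_nhds h0 (fun _ => zero_le)
      fun r => ?_
    have e : ∀ x, ((u + z) (t + r) x - (u + z) t x) / (r : ℂ) - (ut + zt) t x =
        ((u (t + r) x - u t x) / (r : ℂ) - ut t x) + ((z (t + r) x - z t x) / (r : ℂ) - zt t x) := by
      intro x
      simp only [Pi.add_apply]
      ring
    simp only [e]
    refine lintegral_mul_enorm_add_sq_le _ ?_ ?_
    · exact ((hc.continuous.pow 2).inv₀ fun x =>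
        (pow_pos (hpos x) 2).ne').measurable.ennreal_ofReal.aemeasurable
    · simp only [div_eq_mul_inv]
      exact (AEStronglyMeasurable.mul_const ((hm h (t + r)).1.sub (hm h t).1) _).sub
        (hm h t).2.2.aestronglyMeasurable
  · have hφ : IsTest φ := ⟨h1, h2⟩
    have hφ' : IsTest fun x => ((c x : ℂ) ^ 2)⁻¹ * φ x := by
      simpa only [inv_pow] using hφ.mul_left ((contDiff_inv_ofReal_comp hc hpos).pow 2)
    have e1 : (fun s => ∫ x, ((c x : ℂ) ^ 2)⁻¹ * (ut + zt) s x * φ x) = fun s =>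
        (∫ x, ((c x : ℂ) ^ 2)⁻¹ * ut s x * φ x) + ∫ x, ((c x : ℂ) ^ 2)⁻¹ * zt s x * φ x := by
      ext s
      rw [← integral_add]
      · congr 1 with x
        simp only [Pi.add_apply]
        ring
      · refine (hφ'.integrable_mul_locallyIntegrable (hm h s).2.2).congr
          (Eventually.of_forall fun x => ?_)
        ring
      · refine (hφ'.integrable_mul_locallyIntegrable (hm h' s).2.2).congr
          (Eventually.of_forall fun x => ?_)
        ring
    have e2 : ∫ x, (u + z) t x * Laplacian.laplacian φ x =
        (∫ x, u t x * Laplacian.laplacian φ x) + ∫ x, z t x * Laplacian.laplacian φ x := by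
      rw [← integral_add (hφ.laplacian.integrable_mul_locallyIntegrable (hm h t).2.1)
        (hφ.laplacian.integrable_mul_locallyIntegrable (hm h' t).2.1)]
      congr 1 with x
      simp only [Pi.add_apply]
      ring
    rw [e1, e2]
    exact (h.4 φ h1 h2 t).add (h'.4 φ h1 h2 t)

end

end

noncomputable section

/-! ### The Cayley transform of `i D* D` -/

section Resolvent

variable {F E : Type*} [NormedAddCommGroup F] [InnerProductSpace ℂ F]
  [NormedAddCommGroup E] [InnerProductSpace ℂ E]
  (Γ : Submodule ℂ (WithLp 2 (F × E))) [Γ.HasOrthogonalProjection]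

/-- If `Γ ⊆ F × E` is the graph of `D`, this is `(1 + D* D)⁻¹`. -/
def graphResolvent : F →L[ℂ] F :=
  WithLp.fstL 2 ℂ F E ∘L Γ.starProjection ∘L
    (WithLp.prodContinuousLinearEquiv 2 ℂ F E).symm.toContinuousLinearMap ∘L
      ContinuousLinearMap.inl ℂ F E

lemma graphResolvent_apply (h : F) :
    graphResolvent Γ h = (Γ.starProjection (WithLp.toLp 2 (h, 0))).fst := rfl

lemma inner_graphResolvent_left (h h' : F) : inner ℂ (graphResolvent Γ h) h' =
    inner ℂ (Γ.starProjection (WithLp.toLp 2 (h, 0))) (WithLp.toLp 2 (h', 0)) := by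
  simp [WithLp.prod_inner_apply, graphResolvent_apply]

lemma isSelfAdjoint_graphResolvent [CompleteSpace F] : IsSelfAdjoint (graphResolvent Γ) := by
  rw [ContinuousLinearMap.isSelfAdjoint_iff_isSymmetric]
  intro x y
  change inner ℂ (graphResolvent Γ x) y = inner ℂ x (graphResolvent Γ y)
  rw [inner_graphResolvent_left, Submodule.inner_starProjection_left_eq_right,
    ← inner_conj_symm x, inner_graphResolvent_left, inner_conj_symm]

variable {Γ}

/-- The quadratic form of the resolvent at `h` is the squared norm of the projection of `(h, 0)`
onto `Γ`. -/
lemma eq_zero_of_graphResolvent_eq_zero (hdense : ∀ h : F, WithLp.toLp 2 (h, (0 : E)) ∈ Γᗮ → h = 0)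
    (h : F) (h0 : graphResolvent Γ h = 0) : h = 0 := by
  apply hdense
  have := inner_graphResolvent_left Γ h h
  rw [h0, inner_zero_left] at this
  rw [← Submodule.starProjection_apply_eq_zero_iff, ← inner_self_eq_zero (𝕜 := ℂ),
    ← Submodule.inner_starProjection_left_eq_right, Submodule.starProjection_eq_self_iff.2 (Submodule.starProjection_apply_mem _ _), ← this]

/-- With `K = D g` and `h - g = D* K`, the splitting `(h, 0) = (g, K) + (h - g, -K)` is the
orthogonal one. -/
lemma graphResolvent_eq {g h : F} {K : E} (h1 : WithLp.toLp 2 (g, K) ∈ Γ)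
    (h2 : WithLp.toLp 2 (h - g, -K) ∈ Γᗮ) : graphResolvent Γ h = g := by
  have h3 : WithLp.toLp 2 (h, (0 : E)) - WithLp.toLp 2 (g, K) ∈ Γᗮ := by
    rw [← WithLp.toLp_sub]
    simpa using h2
  rw [graphResolvent_apply, Submodule.eq_starProjection_of_mem_orthogonal h1 h3,
    WithLp.toLp_fst]

end Resolvent

/-! ### Unitary Cayley transform built from a self-adjoint resolvent. -/

section ResolventCayley

variable {F : Type*} [NormedAddCommGroup F] [InnerProductSpace ℂ F] [CompleteSpace F]

/-- `B - i (1 - B)`, which is `(1 - i L) B` if `B = (1 + L)⁻¹`. -/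
def resolventDenom (B : F →L[ℂ] F) : F →L[ℂ] F := B - Complex.I • (1 - B)

/-- The Cayley transform `(1 + i L) / (1 - i L)` for `B = (1 + L)⁻¹`. -/
def resolventCayley (B : F →L[ℂ] F) : F →L[ℂ] F :=
  star (resolventDenom B) * Ring.inverse (resolventDenom B)

variable {B : F →L[ℂ] F}

lemma star_resolventDenom (hB : IsSelfAdjoint B) :
    star (resolventDenom B) = B + Complex.I • (1 - B) := by
  rw [resolventDenom, star_sub, star_smul, star_sub, star_one, hB.star_eq]
  simp

/-- The denominator is `(1 + i) B - i`, a multiple of `B - z` with `z = (1 + i) / 2` not real, hence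
outside the spectrum of `B`. -/
lemma isUnit_resolventDenom (hB : IsSelfAdjoint B) : IsUnit (resolventDenom B) := by
  have hz : ((1 + Complex.I) / 2 : ℂ) ∉ spectrum ℂ B := fun h => by
    have := congrArg Complex.im (hB.mem_spectrum_eq_re h)
    norm_num at this
  have h := (spectrum.notMem_iff.1 hz)
  have e : resolventDenom B = (-(1 + Complex.I)) •
      (algebraMap ℂ (F →L[ℂ] F) ((1 + Complex.I) / 2) - B) := by
    rw [resolventDenom, Algebra.algebraMap_eq_smul_one, smul_sub (-(1 + Complex.I)), smul_smul]
    have : -(1 + Complex.I) * ((1 + Complex.I) / 2) = -Complex.I := by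
      linear_combination (-1 / 2 : ℂ) * Complex.I_sq
    rw [this]
    module
  have h1 : (1 + Complex.I : ℂ) ≠ 0 := fun h => by simpa using congrArg Complex.im h
  rw [e]
  exact h.smul (Units.mk0 (-(1 + Complex.I)) (neg_ne_zero.2 h1))

lemma resolventCayley_apply (hB : IsSelfAdjoint B) (x : F) :
    resolventCayley B (resolventDenom B x) = star (resolventDenom B) x := by
  have := Ring.inverse_mul_cancel _ (isUnit_resolventDenom hB)
  rw [resolventCayley, ← mul_apply_eq_comp, mul_assoc, this, mul_one]

lemma resolventCayley_mem_unitary (hB : IsSelfAdjoint B) :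
    resolventCayley B ∈ unitary (F →L[ℂ] F) := by
  set T := resolventDenom B with hT
  have hu := isUnit_resolventDenom hB
  -- Both are polynomials in `B`; normality of `T` is what makes `T* T⁻¹` unitary.
  have hcomm : T * star T = star T * T := by
    rw [hT, star_resolventDenom hB, resolventDenom]
    have : Commute (B - Complex.I • (1 - B)) (B + Complex.I • (1 - B)) := by
      have h1 : Commute B (1 - B) := (Commute.one_right B).sub_right (Commute.refl B)
      exact ((Commute.refl B).add_right (h1.smul_right _)).sub_left
        ((h1.symm.smul_left _).add_right ((Commute.refl (1 - B)).smul_left _ |>.smul_right _))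
    exact this
  have h1 : T * Ring.inverse T = 1 := Ring.mul_inverse_cancel _ hu
  have h2 : star (Ring.inverse T) * star T = 1 := by rw [← star_mul, h1, star_one]
  have hW : IsUnit (resolventCayley B) := hu.star.mul (isUnit_ringInverse.2 hu)
  refine IsUnit.mem_unitary_of_star_mul_self hW ?_
  rw [resolventCayley, star_mul, star_star]
  calc star (Ring.inverse T) * T * (star T * Ring.inverse T)
      = star (Ring.inverse T) * (T * star T) * Ring.inverse T := by simp only [mul_assoc]
    _ = (star (Ring.inverse T) * star T) * (T * Ring.inverse T) := by
        rw [hcomm]; simp only [mul_assoc]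
    _ = 1 := by rw [h1, h2, one_mul]

lemma eq_zero_of_resolventCayley_eq_neg (hB : IsSelfAdjoint B) (h0 : ∀ x, B x = 0 → x = 0) (x : F)
    (hx : resolventCayley B x = -x) : x = 0 := by
  have hT := Ring.mul_inverse_cancel _ (isUnit_resolventDenom hB)
  obtain ⟨y, rfl⟩ : ∃ y, resolventDenom B y = x :=
    ⟨Ring.inverse (resolventDenom B) x, by rw [← mul_apply_eq_comp, hT, one_apply_eq_self]⟩
  rw [resolventCayley_apply hB, star_resolventDenom hB] at hx
  have h1 : (2 : ℂ) • B y = 0 := by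
    simp only [resolventDenom, add_apply, sub_apply, smul_apply, one_apply_eq_self] at hx
    rw [eq_neg_iff_add_eq_zero] at hx
    rw [← hx]
    module
  rw [h0 y ((smul_eq_zero_iff_right two_ne_zero).1 h1), map_zero]

/-- Here `x - y = L y`, so this is the relation `W (y - y') = y + y'` for `y' = i L y`. -/
lemma resolventCayley_sub (hB : IsSelfAdjoint B) {x y : F} (h : B x = y) :
    resolventCayley B (y - Complex.I • (x - y)) = y + Complex.I • (x - y) := by
  have h1 := resolventCayley_apply hB x
  rw [star_resolventDenom hB] at h1
  simpa only [resolventDenom, add_apply, sub_apply, smul_apply, one_apply_eq_self, h] using h1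

end ResolventCayley

variable {d : ℕ}

/-! ### Solutions of the Schrödinger equation -/

/-- `(1 - Δ)⁻¹` on `L²(ℝᵈ)`. -/
def laplacianResolvent (d : ℕ) : L2C d →L[ℂ] L2C d :=
  graphResolvent (gradGraph fun _ : Space d => (1 : ℝ))

/-- The unitary group `e^{-itΔ}` on `L²(ℝᵈ)`. -/
def schrodingerGroup (d : ℕ) (t : ℝ) : L2C d →L[ℂ] L2C d :=
  cayleyGroup (resolventCayley (laplacianResolvent d)) t

lemma isSelfAdjoint_laplacianResolvent : IsSelfAdjoint (laplacianResolvent d) :=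
  isSelfAdjoint_graphResolvent _

lemma resolventCayley_laplacianResolvent_ker (x : L2C d)
    (hx : resolventCayley (laplacianResolvent d) x = -x) : x = 0 :=
  eq_zero_of_resolventCayley_eq_neg isSelfAdjoint_laplacianResolvent
    (eq_zero_of_graphResolvent_eq_zero
      (eq_zero_of_mem_gradGraph_orthogonal contDiff_const fun _ => one_pos)) x hx

lemma norm_schrodingerGroup_apply (t : ℝ) (x : L2C d) : ‖schrodingerGroup d t x‖ = ‖x‖ :=
  norm_cayleyGroup_apply (resolventCayley_mem_unitary isSelfAdjoint_laplacianResolvent)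
    resolventCayley_laplacianResolvent_ker t x

lemma schrodingerGroup_zero (x : L2C d) : schrodingerGroup d 0 x = x :=
  cayleyGroup_zero (resolventCayley_mem_unitary isSelfAdjoint_laplacianResolvent)
    resolventCayley_laplacianResolvent_ker x

lemma continuous_schrodingerGroup (x : L2C d) : Continuous fun t => schrodingerGroup d t x :=
  continuous_cayleyGroup (resolventCayley_mem_unitary isSelfAdjoint_laplacianResolvent)
    resolventCayley_laplacianResolvent_ker x

lemma laplacianResolvent_apply {φ : Space d → ℂ} (hφ : IsTest φ) :
    laplacianResolvent d (toL2 φ - toL2 (Laplacian.laplacian φ)) = toL2 φ := by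
  have h1 := toL2_mem_gradGraph (fun _ : Space d => (1 : ℝ)) hφ
  have h2 := neg_mem (laplacian_mem_gradGraph_orthogonal (c := fun _ : Space d => (1 : ℝ))
    contDiff_const (fun _ => one_pos) hφ)
  simp only [Complex.ofReal_one, inv_one, one_mul] at h1 h2
  refine graphResolvent_eq h1 ?_
  rw [← WithLp.toLp_neg, Prod.neg_mk] at h2
  convert h2 using 3
  abel

lemma resolventCayley_laplacianResolvent_sub {φ : Space d → ℂ} (hφ : IsTest φ) :
    resolventCayley (laplacianResolvent d)
      (toL2 φ - -(Complex.I • toL2 (Laplacian.laplacian φ))) =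
      toL2 φ + -(Complex.I • toL2 (Laplacian.laplacian φ)) := by
  have h := resolventCayley_sub isSelfAdjoint_laplacianResolvent (laplacianResolvent_apply hφ)
  rwa [sub_sub_cancel_left, smul_neg] at h

lemma hasDerivAt_inner_schrodingerGroup {φ : Space d → ℂ} (hφ : IsTest φ) (x : L2C d) (t : ℝ) :
    HasDerivAt (fun t => inner ℂ (toL2 φ) (schrodingerGroup d t x))
      (-Complex.I * inner ℂ (toL2 (Laplacian.laplacian φ)) (schrodingerGroup d t x)) t := by
  have h1 := resolventCayley_laplacianResolvent_sub hφ
  have h2 := congrArg (fun y => (-Complex.I) • y)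
    (resolventCayley_laplacianResolvent_sub hφ.laplacian)
  simp only [← map_smul, smul_sub, smul_add, neg_smul] at h2
  have h := hasDerivAt_inner_cayleyGroup
    (resolventCayley_mem_unitary isSelfAdjoint_laplacianResolvent)
    resolventCayley_laplacianResolvent_ker h1 h2 x t
  refine h.congr_deriv ?_
  rw [inner_neg_left, neg_neg, inner_smul_left, Complex.conj_I]
  rfl

lemma laplacian_conj {φ : Space d → ℂ} (hφ : IsTest φ) :
    Laplacian.laplacian (fun x => starRingEnd ℂ (φ x)) =
      fun x => starRingEnd ℂ (Laplacian.laplacian φ x) := by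
  ext x
  rw [laplacian_eq_sum_partialDeriv hφ.conj, laplacian_eq_sum_partialDeriv hφ, map_sum]
  refine Finset.sum_congr rfl fun i _ => ?_
  rw [show partialDeriv i (fun x => starRingEnd ℂ (φ x)) =
    fun x => starRingEnd ℂ (partialDeriv i φ x) from funext (partialDeriv_conj hφ i),
    partialDeriv_conj (hφ.partialDeriv i)]

lemma eLpNorm_coeFn_sub (x y : L2C d) :
    eLpNorm ((x : Space d → ℂ) - (y : Space d → ℂ)) 2 volume = ‖x - y‖ₑ := by
  rw [Lp.enorm_def]
  exact eLpNorm_congr_ae (Lp.coeFn_sub x y).symm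

lemma isSchrodingerSolution_schrodingerGroup (σ : ℤˣ) (k s : ℝ) (x : L2C d) :
    IsSchrodingerSolution σ k
      (fun t => (schrodingerGroup d (((σ : ℤ) : ℝ) / (2 * k) * (t - s)) x : Space d → ℂ)) := by
  -- The equation reads `∂ₜu = -i (σ / (2k)) Δu`, which is the flow `e^{-iτΔ}` in the rescaled time.
  set τ : ℝ → ℝ := fun t => ((σ : ℤ) : ℝ) / (2 * k) * (t - s) with hτ
  have hτd : ∀ t, HasDerivAt τ (((σ : ℤ) : ℝ) / (2 * k)) t := fun t => by
    simpa using ((hasDerivAt_id t).sub_const s).const_mul (((σ : ℤ) : ℝ) / (2 * k))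
  refine ⟨fun t => Lp.memLp _, fun t => ?_, fun φ h1 h2 t => ?_⟩
  · simp only [eLpNorm_coeFn_sub]
    have : Continuous fun r => ‖schrodingerGroup d (τ r) x - schrodingerGroup d (τ t) x‖ₑ :=
      (((continuous_schrodingerGroup x).comp (by fun_prop)).sub continuous_const).enorm
    simpa using this.tendsto t
  · have hφ : IsTest φ := ⟨h1, h2⟩
    have h := (hasDerivAt_inner_schrodingerGroup hφ.conj x (τ t)).scomp t (hτd t)
    simp only [Function.comp_def, inner_conj_eq_integral hφ, laplacian_conj hφ,
      inner_conj_eq_integral hφ.laplacian] at h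
    refine ⟨_, h, ?_⟩
    simp only [Complex.real_smul]
    push_cast
    linear_combination (((σ : ℤ) : ℂ) / (2 * k) * (1 / k) *
      ∫ y, schrodingerGroup d (τ t) x y * Laplacian.laplacian φ y) * Complex.I_sq

/-- Square integrable data at time `s` have a solution that preserves the norm. -/
lemma exists_isSchrodingerSolution (σ : ℤˣ) (k s : ℝ) {f : Space d → ℂ} (hf : MemLp f 2 volume) :
    ∃ z, IsSchrodingerSolution σ k z ∧ z s =ᵐ[volume] f ∧
      ∀ t, eLpNorm (z t) 2 volume = eLpNorm f 2 volume := by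
  refine ⟨_, isSchrodingerSolution_schrodingerGroup σ k s (toL2 f), ?_, fun t => ?_⟩
  · simp only [sub_self, mul_zero, schrodingerGroup_zero]
    exact toL2_ae hf
  · rw [← Lp.enorm_def, ← ofReal_norm, norm_schrodingerGroup_apply, ofReal_norm, Lp.enorm_def]
    exact eLpNorm_congr_ae (toL2_ae hf)

lemma IsSchrodingerSolution.add {σ : ℤˣ} {k : ℝ} {u z : ℝ → Space d → ℂ}
    (h : IsSchrodingerSolution σ k u) (h' : IsSchrodingerSolution σ k z) :
    IsSchrodingerSolution σ k (u + z) := by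
  refine ⟨fun t => (h.1 t).add (h'.1 t), fun t => ?_, fun φ h1 h2 t => ?_⟩
  · refine tendsto_of_tendsto_of_tendsto_of_le_of_le tendsto_const_nhds
      (by simpa using (h.2 t).add (h'.2 t)) (fun _ => zero_le) fun s => ?_
    simp only [Pi.add_apply, add_sub_add_comm]
    exact eLpNorm_add_le ((h.1 s).sub (h.1 t)).1 ((h'.1 s).sub (h'.1 t)).1 (by norm_num)
  · have hφ : IsTest φ := ⟨h1, h2⟩
    obtain ⟨D, hD, e⟩ := h.3 φ h1 h2 t
    obtain ⟨D', hD', e'⟩ := h'.3 φ h1 h2 t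
    have split : ∀ {ψ : Space d → ℂ}, IsTest ψ → ∀ s, ∫ x, (u + z) s x * ψ x =
        (∫ x, u s x * ψ x) + ∫ x, z s x * ψ x := fun hψ s => by
      rw [← integral_add
        (hψ.integrable_mul_locallyIntegrable (MemLp.locallyIntegrable_two (h.1 s)))
        (hψ.integrable_mul_locallyIntegrable (MemLp.locallyIntegrable_two (h'.1 s)))]
      simp only [Pi.add_apply, add_mul]
    refine ⟨D + D', ?_, ?_⟩
    · simp only [split hφ]
      exact hD.add hD'
    · rw [split hφ.laplacian]
      linear_combination e + e'

end

/-! ### The theorem -/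

lemma exists_threshold {α β : ℝ} (hαβ : β < α) (C : ℝ) {c : ℝ} (hc : 0 < c) :
    ∃ k₀ : ℝ, 1 ≤ k₀ ∧ ∀ k, k₀ ≤ k → ∀ {p q r : ℝ≥0∞}, ENNReal.ofReal (c * k ^ (-β)) ≤ p →
      q ≤ ENNReal.ofReal (C * k ^ (-α)) → p ≤ r + q → ENNReal.ofReal (c / 2 * k ^ (-β)) ≤ r := by
  -- For large `k` the small error is at most half of the lower bound `c k^{-β}`, whence the
  -- constant `c / 2`.
  have hlim : Tendsto (fun k : ℝ => C * k ^ (-(α - β))) atTop (𝓝 0) := by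
    simpa using (tendsto_rpow_neg_atTop (sub_pos.2 hαβ)).const_mul C
  obtain ⟨k₁, hk₁⟩ := eventually_atTop.1 (hlim.eventually_le_const (half_pos hc))
  refine ⟨max 1 k₁, le_max_left _ _, fun k hk p q r hp hq hpq => ?_⟩
  have hk0 : 0 < k := one_pos.trans_le ((le_max_left _ _).trans hk)
  have hC : C * k ^ (-α) ≤ c / 2 * k ^ (-β) := by
    have e : k ^ (-α) = k ^ (-(α - β)) * k ^ (-β) := by
      rw [← Real.rpow_add hk0]
      ring_nf
    rw [e, ← mul_assoc]
    exact mul_le_mul_of_nonneg_right (hk₁ k ((le_max_right _ _).trans hk))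
      (Real.rpow_nonneg hk0.le _)
  have hsum : ENNReal.ofReal (c / 2 * k ^ (-β)) + ENNReal.ofReal (c / 2 * k ^ (-β)) ≤
      r + ENNReal.ofReal (c / 2 * k ^ (-β)) := by
    rw [← ENNReal.ofReal_add (by positivity) (by positivity),
      show c / 2 * k ^ (-β) + c / 2 * k ^ (-β) = c * k ^ (-β) by ring]
    exact hp.trans (hpq.trans (add_le_add le_rfl (hq.trans (ENNReal.ofReal_le_ofReal hC))))
  exact (ENNReal.add_le_add_iff_right ENNReal.ofReal_ne_top).1 hsum

theorem mainTheorem3 (d N m : ℕ) (hd : 1 ≤ d) (hN : 1 ≤ N)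
    (J : Set ℝ) (hJ : IsOpen J) (hJc : J.OrdConnected) (h0 : (0 : ℝ) ∈ J)
    (t₁ t₂ : ℝ) (ht₁ : t₁ ∈ J) (ht₂ : t₂ ∈ J)
    (α β C₁ c₁ : ℝ) (hβ : 0 < β) (hαβ : β < α) (hC₁ : 0 < C₁) (hc₁ : 0 < c₁) :
    -- the wave equation, with the energy norm
    (∀ c : Space d → ℝ, ContDiff ℝ ∞ c → (∀ x, 0 < c x) →
      ∀ uGB : ℝ → ℝ → Space d → ℂ, IsWaveBeamSuperposition c N m J uGB →
      (∀ k : ℝ, 1 ≤ k → energyNorm c (uGB k t₁) (timeDeriv (uGB k) t₁) ≠ ⊤ ∧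
        energyNorm c (uGB k t₂) (timeDeriv (uGB k) t₂) ≠ ⊤) →
      ∀ u ut : ℝ → ℝ → Space d → ℂ, (∀ k : ℝ, 1 ≤ k → IsWaveSolution c (u k) (ut k)) →
      (∀ k : ℝ, 1 ≤ k →
        energyNorm c (u k t₁ - uGB k t₁) (ut k t₁ - timeDeriv (uGB k) t₁)
          ≤ ENNReal.ofReal (C₁ * k ^ (-α)) ∧
        ENNReal.ofReal (c₁ * k ^ (-β))
          ≤ energyNorm c (u k t₂ - uGB k t₂) (ut k t₂ - timeDeriv (uGB k) t₂)) →
      ∃ (w₁ w₁t w₂ w₂t : ℝ → ℝ → Space d → ℂ) (c₀ k₀ : ℝ), 0 < c₀ ∧ 1 ≤ k₀ ∧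
        (∀ k : ℝ, 1 ≤ k → IsWaveSolution c (w₁ k) (w₁t k) ∧ IsWaveSolution c (w₂ k) (w₂t k)) ∧
        ∀ k : ℝ, k₀ ≤ k →
          (w₁ k t₁ =ᵐ[volume] uGB k t₁ ∧ w₁t k t₁ =ᵐ[volume] timeDeriv (uGB k) t₁) ∧
          energyNorm c (w₁ k t₁ - uGB k t₁) (w₁t k t₁ - timeDeriv (uGB k) t₁) = 0 ∧
          ENNReal.ofReal (c₀ * k ^ (-β))
            ≤ energyNorm c (w₁ k t₂ - uGB k t₂) (w₁t k t₂ - timeDeriv (uGB k) t₂) ∧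
          ENNReal.ofReal (c₀ * k ^ (-β))
            ≤ energyNorm c (w₂ k t₁ - uGB k t₁) (w₂t k t₁ - timeDeriv (uGB k) t₁) ∧
          (w₂ k t₂ =ᵐ[volume] uGB k t₂ ∧ w₂t k t₂ =ᵐ[volume] timeDeriv (uGB k) t₂) ∧
          energyNorm c (w₂ k t₂ - uGB k t₂) (w₂t k t₂ - timeDeriv (uGB k) t₂) = 0) ∧
    -- the semiclassical Schrödinger equation, with the L² norm
    (∀ σ : ℤˣ, ∀ uGB : ℝ → ℝ → Space d → ℂ, IsSchrodingerBeamSuperposition σ N m J uGB →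
      (∀ k : ℝ, 1 ≤ k → MemLp (uGB k t₁) 2 volume ∧ MemLp (uGB k t₂) 2 volume) →
      ∀ u : ℝ → ℝ → Space d → ℂ, (∀ k : ℝ, 1 ≤ k → IsSchrodingerSolution σ k (u k)) →
      (∀ k : ℝ, 1 ≤ k →
        eLpNorm (u k t₁ - uGB k t₁) 2 volume ≤ ENNReal.ofReal (C₁ * k ^ (-α)) ∧
        ENNReal.ofReal (c₁ * k ^ (-β)) ≤ eLpNorm (u k t₂ - uGB k t₂) 2 volume) →
      ∃ (w₁ w₂ : ℝ → ℝ → Space d → ℂ) (c₀ k₀ : ℝ), 0 < c₀ ∧ 1 ≤ k₀ ∧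
        (∀ k : ℝ, 1 ≤ k → IsSchrodingerSolution σ k (w₁ k) ∧ IsSchrodingerSolution σ k (w₂ k)) ∧
        ∀ k : ℝ, k₀ ≤ k →
          eLpNorm (w₁ k t₁ - uGB k t₁) 2 volume = 0 ∧
          ENNReal.ofReal (c₀ * k ^ (-β)) ≤ eLpNorm (w₁ k t₂ - uGB k t₂) 2 volume ∧
          ENNReal.ofReal (c₀ * k ^ (-β)) ≤ eLpNorm (w₂ k t₁ - uGB k t₁) 2 volume ∧
          eLpNorm (w₂ k t₂ - uGB k t₂) 2 volume = 0) := by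
  obtain ⟨k₀, hk₀, hk⟩ := exists_threshold hαβ C₁ hc₁
  refine ⟨fun c hc hpos uGB _ hfin u ut hu hest => ?_, fun σ uGB _ hfin u hu hest => ?_⟩
  -- The corrector, with data `uGB - u` at time `s`; its energy at all times is that of the error of
  -- `u` at `s`. For `k < 1` any function will do.
  · have hex : ∀ s, (s = t₁ ∨ s = t₂) → ∀ k, ∃ z zt : ℝ → Space d → ℂ, 1 ≤ k →
        IsWaveSolution c z zt ∧ z s =ᵐ[volume] uGB k s - u k s ∧
        zt s =ᵐ[volume] timeDeriv (uGB k) s - ut k s ∧ ∀ t, energyNorm c (z t) (zt t) =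
          energyNorm c (u k s - uGB k s) (ut k s - timeDeriv (uGB k) s) := by
      intro s hs k
      by_cases h1 : 1 ≤ k
      · have h2 : energyNorm c (uGB k s) (timeDeriv (uGB k) s) ≠ ⊤ := by
          rcases hs with rfl | rfl
          exacts [(hfin k h1).1, (hfin k h1).2]
        obtain ⟨v, hv⟩ := exists_isState hc hpos h2
        obtain ⟨v', hv'⟩ := exists_isState hc hpos ((hu k h1).1 s)
        obtain ⟨z, zt, hz, e1, e2, e3⟩ :=
          exists_isWaveSolution hc hpos ((hv.sub hv').energyNorm_ne_top hc hpos) s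
        exact ⟨z, zt, fun _ => ⟨hz, e1, e2, fun t => by
          rw [e3, ← energyNorm_neg, neg_sub, neg_sub]⟩⟩
      · exact ⟨0, 0, fun h => absurd h h1⟩
    choose z zt hz using hex t₁ (Or.inl rfl)
    choose y yt hy using hex t₂ (Or.inr rfl)
    refine ⟨fun k => u k + z k, fun k => ut k + zt k, fun k => u k + y k, fun k => ut k + yt k,
      c₁ / 2, k₀, by positivity, hk₀, fun k h1 => ⟨(hu k h1).add hc hpos (hz k h1).1,
        (hu k h1).add hc hpos (hy k h1).1⟩, fun k hkk => ?_⟩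
    have h1 := hk₀.trans hkk
    obtain ⟨-, hz1, hz2, hz3⟩ := hz k h1
    obtain ⟨-, hy1, hy2, hy3⟩ := hy k h1
    have key : ∀ {p p' q q' : Space d → ℂ}, ENNReal.ofReal (c₁ * k ^ (-β)) ≤ energyNorm c p p' →
        energyNorm c q q' ≤ ENNReal.ofReal (C₁ * k ^ (-α)) →
        ENNReal.ofReal (c₁ / 2 * k ^ (-β)) ≤ energyNorm c (p + q) (p' + q') := by
      intro p p' q q' hp hq
      refine hk k hkk hp hq ?_
      -- Reverse triangle inequality: `p = (p + q) - q`, with `p` the large and `q` the small error.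
      have := energyNorm_add_le hc hpos (p + q) (p' + q') (-q) (-q')
      rwa [add_neg_cancel_right, add_neg_cancel_right, energyNorm_neg] at this
    have data : ∀ {a b r : Space d → ℂ}, b =ᵐ[volume] r - a → a + b =ᵐ[volume] r := by
      intro a b r h
      filter_upwards [h] with x hx
      simp [hx]
    have zero : ∀ {a r : Space d → ℂ}, a =ᵐ[volume] r → a - r =ᵐ[volume] 0 := by
      intro a r h
      filter_upwards [h] with x hx
      simp [hx]
    refine ⟨⟨data hz1, data hz2⟩, energyNorm_eq_zero hc hpos (zero (data hz1)) (zero (data hz2)),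
      ?_, ?_, ⟨data hy1, data hy2⟩,
      energyNorm_eq_zero hc hpos (zero (data hy1)) (zero (data hy2))⟩
    · have := key (hest k h1).2 ((hz3 t₂).trans_le (hest k h1).1)
      simpa only [Pi.add_apply, add_sub_right_comm] using this
    -- The roles are exchanged: at `t₁` the corrector is the large term, since it keeps the energy
    -- of the error at `t₂`, and the error of `u` is the small one.
    · have := key ((hest k h1).2.trans (hy3 t₁).ge) (hest k h1).1
      simpa only [Pi.add_apply, add_sub_assoc, add_comm (y k t₁), add_comm (yt k t₁),
        sub_add_eq_add_sub] using this
  -- The same correction, with conservation of the `L²` norm in place of the energy.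
  · have hex : ∀ s, (s = t₁ ∨ s = t₂) → ∀ k, ∃ z : ℝ → Space d → ℂ, 1 ≤ k →
        IsSchrodingerSolution σ k z ∧ z s =ᵐ[volume] uGB k s - u k s ∧
        ∀ t, eLpNorm (z t) 2 volume = eLpNorm (u k s - uGB k s) 2 volume := by
      intro s hs k
      by_cases h1 : 1 ≤ k
      · have h2 : MemLp (uGB k s) 2 volume := by
          rcases hs with rfl | rfl
          exacts [(hfin k h1).1, (hfin k h1).2]
        obtain ⟨z, hz, e1, e2⟩ := exists_isSchrodingerSolution σ k s (h2.sub ((hu k h1).1 s))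
        exact ⟨z, fun _ => ⟨hz, e1, fun t => by rw [e2, eLpNorm_sub_comm]⟩⟩
      · exact ⟨0, fun h => absurd h h1⟩
    choose z hz using hex t₁ (Or.inl rfl)
    choose y hy using hex t₂ (Or.inr rfl)
    refine ⟨fun k => u k + z k, fun k => u k + y k, c₁ / 2, k₀, by positivity, hk₀,
      fun k h1 => ⟨(hu k h1).add (hz k h1).1, (hu k h1).add (hy k h1).1⟩, fun k hkk => ?_⟩
    have h1 := hk₀.trans hkk
    obtain ⟨hzs, hz1, hz2⟩ := hz k h1
    obtain ⟨hys, hy1, hy2⟩ := hy k h1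
    have key : ∀ {p q : Space d → ℂ}, AEStronglyMeasurable p volume →
        AEStronglyMeasurable q volume → ENNReal.ofReal (c₁ * k ^ (-β)) ≤ eLpNorm p 2 volume →
        eLpNorm q 2 volume ≤ ENNReal.ofReal (C₁ * k ^ (-α)) →
        ENNReal.ofReal (c₁ / 2 * k ^ (-β)) ≤ eLpNorm (p + q) 2 volume := by
      intro p q hpm hqm hp hq
      refine hk k hkk hp hq ?_
      have := eLpNorm_add_le (hpm.add hqm) hqm.neg (p := 2) (by norm_num)
      rwa [add_neg_cancel_right, eLpNorm_neg] at this
    have zero : ∀ {a b r : Space d → ℂ}, b =ᵐ[volume] r - a →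
        eLpNorm (a + b - r) 2 volume = 0 := by
      intro a b r h
      rw [← eLpNorm_zero (p := 2) (μ := (volume : Measure (Space d))) (ε := ℂ)]
      refine eLpNorm_congr_ae ?_
      filter_upwards [h] with x hx
      simp [hx]
    refine ⟨zero hz1, ?_, ?_, zero hy1⟩
    · have := key (((hu k h1).1 t₂).sub (hfin k h1).2).1 (hzs.1 t₂).1 (hest k h1).2
        ((hz2 t₂).trans_le (hest k h1).1)
      simpa only [Pi.add_apply, add_sub_right_comm] using this
    · have := key (hys.1 t₁).1 (((hu k h1).1 t₁).sub (hfin k h1).1).1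
        ((hest k h1).2.trans (hy2 t₁).ge) (hest k h1).1
      simpa only [Pi.add_apply, add_sub_assoc, add_comm (y k t₁), sub_add_eq_add_sub] using this
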